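/- **Definitions.** A *biquandle* is a set $X$ with operations $\underline{\triangleright},\overline{\triangleright}$ such that $x\,\underline{\triangleright}\,x=x\,\overline{\triangleright}\,x$; the maps $x\mapsto x\,\overline{\triangleright}\,y$, $x\mapsto x\,\underline{\triangleright}\,y$ and $(x,y)\mapsto(y\,\overline{\triangleright}\,x,\;x\,\underline{\triangleright}\,y)$ are bijective; and $(x\underline{\triangleright}y)\underline{\triangleright}(z\underline{\triangleright}y)=(x\underline{\triangleright}z)\underline{\triangleright}(y\overline{\triangleright}z)$, $(x\underline{\triangleright}y)\overline{\triangleright}(z\underline{\triangleright}y)=(x\overline{\triangleright}z)\underline{\triangleright}(y\overline{\triangleright}z)$, $(x\overline{\triangleright}y)\overline{\triangleright}(z\overline{\triangleright}y)=(x\overline{\triangleright}z)\overline{\triangleright}(y\underline{\triangleright}z)$ for all $x,y,z$. A *biquandle bracket* $\beta$ over $X$ with values in a commutative ring $R$ with identity consists of maps $A,B:X\times X\to R^\times$ and elements $w\in R^\times$, $\delta\in R$ such that, for all $x,y,z\in X$, $-A_{x,x}^2B_{x,x}^{-1}=w$, $-A_{x,y}^{-1}B_{x,y}-A_{x,y}B_{x,y}^{-1}=\delta$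 and, writing $A_1,A_2,A_3$ for $A_{x,y},\,A_{y,z},\,A_{x\underline{\triangleright}y,\,z\overline{\triangleright}y}$ and $A_1',A_2',A_3'$ for $A_{x,z},\,A_{y\overline{\triangleright}x,\,z\overline{\triangleright}x},\,A_{x\underline{\triangleright}z,\,y\underline{\triangleright}z}$, and likewise for $B$, $$A_1A_2A_3=A_1'A_2'A_3',\quad A_1B_2B_3=B_1'B_2'A_3',\quad B_1A_2B_3=B_1'A_2'B_3',$$ $$A_1A_2B_3=A_1'B_2'A_3'+A_1'A_2'B_3'+\delta A_1'B_2'B_3'+B_1'B_2'B_3',$$ $$B_1A_2A_3+A_1B_2A_3+\delta B_1B_2A_3+B_1B_2B_3=B_1'A_2'A_3'.$$ Let $D$ be a diagram of an oriented classical link $L$. The fundamental biquandle $\mathcal B(L)$ is generated by the semiarcs of $D$ with two relations at each crossing: if $x$ (on the under strand) and $y$ (on the over strand) are the two semiarcs on the right of the crossing, drawn with both strands going up, then the semiarcs on its left are $x\,\underline{\triangleright}\,y$ (under strand) and $y\,\overline{\triangleright}\,x$ (over strand). For finite $X$, an element $f\in\mathrm{Hom}(\mathcal B(L),X)$ is the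 same as an $X$-coloring of the semiarcs of $D$; its bracket value is $$\beta(f)=w^{n_--n_+}\sum_{\sigma}\Big(\prod_c \sigma(c)\Big)\,\delta^{k(\sigma)}\in R,$$ where $n_\pm$ are the numbers of positive and negative crossings and $\sigma$ runs over the choices of a smoothing at every crossing $c$; with $x,y$ the colors above, the smoothing compatible with the orientation contributes $A_{x,y}$ at a positive and $A_{x,y}^{-1}$ at a negative crossing, the other smoothing contributes $B_{x,y}$, respectively $B_{x,y}^{-1}$; and $k(\sigma)$ is the number of closed curves of $\sigma$. For a set $S$ of biquandle endomorphisms of $X$, the *biquandle bracket quiver* $\mathcal{BBQ}^S_{X,\beta}(L)$ has vertex set $V=\mathrm{Hom}(\mathcal B(L),X)$ with weights $\beta(f)$, and edge set $E=V\times S$, the edge $(f,\phi)$ going from $f$ to $\phi\circ f$. **Corollary.** Let $X$ be a finite biquandle, $R$ a commutative ring with identity, $\beta$ a biquandle bracket over $X$ with values in $R$, and $S$ a set of biquandle endomorphisms of $X$. The in-degree biquandle bracket polynomial and the biquandle bracket 2-variable polynomial $$\Phi^{S,\deg^+}_{X,\beta}(L)=\sum_{v\in V}u^{\beta(v)}v^{\deg^+(v)},\qquad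 \Phi^{S,2}_{X,\beta}(L)=\sum_{e\in E}s^{\beta(s(e))}t^{\beta(t(e))}$$ (finite sums of formal monomials with exponents in $R\times\mathbb N$ and $R\times R$; $\deg^+(v)$ is the number of edges ending at $v$; $s(e),t(e)$ are the source and target of $e$) are invariants of oriented classical knots and links: any two planar diagrams that are related by planar isotopy and oriented Reidemeister moves give the same two polynomials. -/

import Mathlib

universe u v

/-! ## Biquandles -/

/-- A biquandle: `underOp x y` and `overOp x y` are the operations usually written
`x \underline{\triangleright} y` and `x \overline{\triangleright} y`. -/
class Biquandle (X : Type u) where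
  underOp : X → X → X
  overOp : X → X → X
  under_self : ∀ x, underOp x x = overOp x x
  over_bijective : ∀ y, Function.Bijective (fun x => overOp x y)
  under_bijective : ∀ y, Function.Bijective (fun x => underOp x y)
  side_bijective : Function.Bijective (fun p : X × X => (overOp p.2 p.1, underOp p.1 p.2))
  exchange_under_under : ∀ x y z,
    underOp (underOp x y) (underOp z y) = underOp (underOp x z) (overOp y z)
  exchange_under_over : ∀ x y z,
    overOp (underOp x y) (underOp z y) = underOp (overOp x z) (overOp y z)
  exchange_over_over : ∀ x y z,
    overOp (overOp x y) (overOp z y) = overOp (overOp x z) (underOp y z)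

infixl:70 " ▷ᵤ " => Biquandle.underOp
infixl:70 " ▷ₒ " => Biquandle.overOp

/-- Biquandle homomorphisms. -/
structure BiquandleHom (X : Type u) (Y : Type v) [Biquandle X] [Biquandle Y] where
  toFun : X → Y
  map_under : ∀ a b, toFun (a ▷ᵤ b) = toFun a ▷ᵤ toFun b
  map_over : ∀ a b, toFun (a ▷ₒ b) = toFun a ▷ₒ toFun b

namespace BiquandleHom

theorem toFun_injective {X : Type u} {Y : Type v} [Biquandle X] [Biquandle Y] :
    Function.Injective (BiquandleHom.toFun : BiquandleHom X Y → X → Y) := by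
  rintro ⟨f, _, _⟩ ⟨g, _, _⟩ h
  cases h
  rfl

/-- The composite `g ∘ f`. -/
def comp {X Y Z : Type*} [Biquandle X] [Biquandle Y] [Biquandle Z]
    (g : BiquandleHom Y Z) (f : BiquandleHom X Y) : BiquandleHom X Z where
  toFun := fun x => g.toFun (f.toFun x)
  map_under := fun a b => by rw [f.map_under, g.map_under]
  map_over := fun a b => by rw [f.map_over, g.map_over]

instance finite {X : Type u} {Y : Type v} [Biquandle X] [Biquandle Y] [Finite X] [Finite Y] :
    Finite (BiquandleHom X Y) :=
  Finite.of_injective _ toFun_injective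

end BiquandleHom

/-- A biquandle bracket over the biquandle `X` with values in the commutative ring `R`.
`w` is the value of a positive crossing (kink) and `δ` the value of a simple closed curve; for
nonempty `X` both are determined by `A` and `B`. -/
structure BiquandleBracket (X : Type u) (R : Type v) [Biquandle X] [CommRing R] where
  A : X → X → Rˣ
  B : X → X → Rˣ
  w : Rˣ
  δ : R
  w_eq : ∀ x, -(A x x ^ 2 * (B x x)⁻¹) = w
  δ_eq : ∀ x y, -(((A x y)⁻¹ * B x y : Rˣ) : R) - ((A x y * (B x y)⁻¹ : Rˣ) : R) = δ
  AAA : ∀ x y z, (A x y * A y z * A (x ▷ᵤ y) (z ▷ₒ y) : R) =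
    A x z * A (y ▷ₒ x) (z ▷ₒ x) * A (x ▷ᵤ z) (y ▷ᵤ z)
  ABB : ∀ x y z, (A x y * B y z * B (x ▷ᵤ y) (z ▷ₒ y) : R) =
    B x z * B (y ▷ₒ x) (z ▷ₒ x) * A (x ▷ᵤ z) (y ▷ᵤ z)
  BAB : ∀ x y z, (B x y * A y z * B (x ▷ᵤ y) (z ▷ₒ y) : R) =
    B x z * A (y ▷ₒ x) (z ▷ₒ x) * B (x ▷ᵤ z) (y ▷ᵤ z)
  AAB : ∀ x y z, (A x y * A y z * B (x ▷ᵤ y) (z ▷ₒ y) : R) =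
    A x z * B (y ▷ₒ x) (z ▷ₒ x) * A (x ▷ᵤ z) (y ▷ᵤ z) +
      A x z * A (y ▷ₒ x) (z ▷ₒ x) * B (x ▷ᵤ z) (y ▷ᵤ z) +
      δ * A x z * B (y ▷ₒ x) (z ▷ₒ x) * B (x ▷ᵤ z) (y ▷ᵤ z) +
      B x z * B (y ▷ₒ x) (z ▷ₒ x) * B (x ▷ᵤ z) (y ▷ᵤ z)
  BAA : ∀ x y z, (B x y * A y z * A (x ▷ᵤ y) (z ▷ₒ y) +
      A x y * B y z * A (x ▷ᵤ y) (z ▷ₒ y) +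
      δ * B x y * B y z * A (x ▷ᵤ y) (z ▷ₒ y) +
      B x y * B y z * B (x ▷ᵤ y) (z ▷ₒ y) : R) =
    B x z * A (y ▷ₒ x) (z ▷ₒ x) * A (x ▷ᵤ z) (y ▷ᵤ z)

/-! ## Oriented link diagrams -/

/-- The two strands at a crossing: the under strand `lower` and the over strand `upper`. -/
inductive Strand where
  | lower
  | upper

/-- A (combinatorial) oriented link diagram: finitely many signed crossings, finitely many
semiarcs, and for every crossing and each of its two strands the semiarc `inn` along which the
strand enters the crossing and the semiarc `out` along which it leaves. Every semiarc either runs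
from one crossing to one crossing, or touches no crossing at all and is then a simple closed
component. No planarity is required here; see `LinkDiagram.IsClassical`. -/
structure LinkDiagram where
  Crossing : Type
  Semiarc : Type
  [fintypeCrossing : Fintype Crossing]
  [fintypeSemiarc : Fintype Semiarc]
  /-- `1` for a positive crossing, `-1` for a negative one. -/
  sign : Crossing → ℤˣ
  inn : Crossing × Strand → Semiarc
  out : Crossing × Strand → Semiarc
  inn_injective : Function.Injective inn
  out_injective : Function.Injective out
  range_inn_eq_range_out : Set.range inn = Set.range out

namespace LinkDiagram

attribute [instance] LinkDiagram.fintypeCrossing LinkDiagram.fintypeSemiarc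

/-! ### Classical (planar) diagrams

Draw a crossing with both strands going up. The strand from bottom left to top right is the over
strand if the crossing is positive and the under strand if it is negative. -/

open Classical in
/-- The strand that goes from bottom left to top right. -/
noncomputable def rising (D : LinkDiagram) (c : D.Crossing) : Strand :=
  if D.sign c = 1 then Strand.upper else Strand.lower

open Classical in
/-- The strand that goes from bottom right to top left. -/
noncomputable def falling (D : LinkDiagram) (c : D.Crossing) : Strand :=
  if D.sign c = 1 then Strand.lower else Strand.upper

/-- The two sides of a semiarc, with respect to its direction. -/
inductive Side where
  | left
  | right

/-- Two sides of semiarcs that meet in one of the four corners (top, left, bottom, right) of a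
crossing. -/
inductive Corner (D : LinkDiagram) : D.Semiarc × Side → D.Semiarc × Side → Prop
  | top (c : D.Crossing) :
      Corner D (D.out (c, D.rising c), Side.left) (D.out (c, D.falling c), Side.right)
  | left (c : D.Crossing) :
      Corner D (D.out (c, D.falling c), Side.left) (D.inn (c, D.rising c), Side.left)
  | bottom (c : D.Crossing) :
      Corner D (D.inn (c, D.rising c), Side.right) (D.inn (c, D.falling c), Side.left)
  | right (c : D.Crossing) :
      Corner D (D.inn (c, D.falling c), Side.right) (D.out (c, D.rising c), Side.right)

/-- The faces of the closed oriented surface that carries the diagram (with one sphere for every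
connected piece of the diagram that is planar). -/
def Face (D : LinkDiagram) : Type := Quot D.Corner

/-- Semiarcs that meet at a crossing. -/
def Touch (D : LinkDiagram) (a b : D.Semiarc) : Prop :=
  ∃ c s t, (a = D.inn (c, s) ∨ a = D.out (c, s)) ∧ (b = D.inn (c, t) ∨ b = D.out (c, t))

/-- The connected pieces of the diagram, as a subset of the surface. -/
def Piece (D : LinkDiagram) : Type := Quot D.Touch

/-- The diagram is classical, i.e. it can be drawn in the sphere (equivalently in the plane)
without further crossings: the surface that carries it has genus zero. A diagram with `n` crossings
has `n` vertices and `2 n` edges (a simple closed component needs one more vertex and one more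
edge), so its Euler characteristic is `#faces - n`, and it is at most twice the number of
connected pieces, with equality exactly in genus zero. -/
def IsClassical (D : LinkDiagram) : Prop :=
  Nat.card D.Face = Nat.card D.Crossing + 2 * Nat.card D.Piece

/-! ### Reidemeister moves -/

/-- `D` is obtained from `D'` by pulling the two strands apart at each crossing in `K`: these
crossings disappear, and at each of them the incoming and the outgoing semiarc of either strand
are joined. -/
def Forgets (D' D : LinkDiagram) (K : Set D'.Crossing) : Prop :=
  ∃ (e : D.Crossing ≃ {c : D'.Crossing // c ∉ K}) (π : D'.Semiarc → D.Semiarc),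
    Function.Surjective π ∧
    (∀ a b, π a = π b ↔
      Relation.EqvGen (fun a b => ∃ c ∈ K, ∃ s, a = D'.inn (c, s) ∧ b = D'.out (c, s)) a b) ∧
    (∀ c, D.sign c = D'.sign (e c)) ∧
    (∀ c s, D.inn (c, s) = π (D'.inn ((e c : D'.Crossing), s))) ∧
    (∀ c s, D.out (c, s) = π (D'.out ((e c : D'.Crossing), s)))

/-- Some semiarc runs from `a` to `b` (if `ε = 1`), or from `b` to `a` (if `ε = -1`). -/
def Consecutive (D : LinkDiagram) (ε : ℤˣ) (a b : D.Crossing × Strand) : Prop :=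
  (ε = 1 ∧ D.out a = D.inn b) ∨ (ε = -1 ∧ D.out b = D.inn a)

/-- The crossing `c` is a kink: a semiarc runs from `c` directly back to `c`, from one strand to
the other. -/
def IsKink (D : LinkDiagram) (c : D.Crossing) : Prop :=
  D.out (c, Strand.lower) = D.inn (c, Strand.upper) ∨
    D.out (c, Strand.upper) = D.inn (c, Strand.lower)

/-- The crossings `c` and `d` span a bigon that a Reidemeister II move removes: one side is the
over strand at both crossings, the other side is the under strand at both, and the signs are
opposite. The two sides may be parallel or antiparallel. -/
def IsBigon (D : LinkDiagram) (c d : D.Crossing) : Prop :=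
  D.sign c = -D.sign d ∧
    D.out (c, Strand.lower) = D.inn (d, Strand.lower) ∧
    ∃ ε, D.Consecutive ε (c, Strand.upper) (d, Strand.upper)

/-- The crossings `p`, `q`, `r` span a triangular face to which a Reidemeister III move applies:
at `p` the top strand crosses over the middle strand, at `q` the top strand crosses over the
bottom strand, at `r` the middle strand crosses over the bottom strand. The condition on the signs
says that at all three crossings the triangle lies in the corner that it has to lie in;
`κ = 1` if `p, q, r` is the counterclockwise order. All eight oriented versions are included. -/
def IsTriangle (D : LinkDiagram) (p q r : D.Crossing) : Prop :=
  p ≠ q ∧ p ≠ r ∧ q ≠ r ∧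
  ∃ top mid bot κ : ℤˣ,
    D.Consecutive top (p, Strand.upper) (q, Strand.upper) ∧
    D.Consecutive mid (p, Strand.lower) (r, Strand.upper) ∧
    D.Consecutive bot (q, Strand.lower) (r, Strand.lower) ∧
    D.sign p = κ * top * mid ∧ D.sign q = κ * top * bot ∧ D.sign r = κ * mid * bot

open Classical in
/-- The exchange of the two crossings on each of the three strands in a Reidemeister III move. -/
noncomputable def triangleSwap (D : LinkDiagram) (p q r : D.Crossing) :
    Equiv.Perm (D.Crossing × Strand) :=
  Equiv.swap (p, Strand.upper) (q, Strand.upper) *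
    Equiv.swap (p, Strand.lower) (r, Strand.upper) *
    Equiv.swap (q, Strand.lower) (r, Strand.lower)

/-- Planar isotopy and the three Reidemeister moves, in all oriented versions. -/
inductive Move : LinkDiagram → LinkDiagram → Prop
  | isotopy {D D' : LinkDiagram} (h : Forgets D D' ∅) : Move D D'
  | r1 {D D' : LinkDiagram} (c : D.Crossing) (hc : D.IsKink c) (h : Forgets D D' {c}) : Move D D'
  | r2 {D D' : LinkDiagram} (c d : D.Crossing) (hcd : D.IsBigon c d) (h : Forgets D D' {c, d}) :
      Move D D'
  | r3 {D D' : LinkDiagram} (p q r : D.Crossing) (hpqr : D.IsTriangle p q r)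
      (e : D'.Crossing ≃ D.Crossing) (g : D'.Semiarc ≃ D.Semiarc)
      (hsign : ∀ c, D'.sign c = D.sign (e c))
      (hinn : ∀ c s, g (D'.inn (c, s)) = D.inn (D.triangleSwap p q r (e c, s)))
      (hout : ∀ c s, g (D'.out (c, s)) = D.out (D.triangleSwap p q r (e c, s))) : Move D D'

end LinkDiagram

/-- Diagrams of oriented classical links. -/
def ClassicalDiagram : Type 1 := {D : LinkDiagram // D.IsClassical}

/-- Oriented classical knots and links: planar diagrams up to planar isotopy and Reidemeister
moves through planar diagrams. -/
def OrientedLink : Type 1 :=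
  Quot (fun D D' : ClassicalDiagram => LinkDiagram.Move D.1 D'.1)

/-- The oriented link that is represented by a diagram. -/
def ClassicalDiagram.link (D : ClassicalDiagram) : OrientedLink := Quot.mk _ D

/-! ## Biquandle colorings and the fundamental biquandle -/

namespace LinkDiagram

/-! If a crossing is drawn with both strands going up, then the semiarcs `x`, `y` on its right and
the semiarcs on its left are related by `x ▷ᵤ y` and `y ▷ₒ x`, where `x` belongs to the under
strand and `y` to the over strand. -/

open Classical in
/-- The under-strand semiarc on the right of the crossing. -/
noncomputable def rightUnder (D : LinkDiagram) (c : D.Crossing) : D.Semiarc :=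
  if D.sign c = 1 then D.inn (c, Strand.lower) else D.out (c, Strand.lower)

open Classical in
/-- The over-strand semiarc on the right of the crossing. -/
noncomputable def rightOver (D : LinkDiagram) (c : D.Crossing) : D.Semiarc :=
  if D.sign c = 1 then D.out (c, Strand.upper) else D.inn (c, Strand.upper)

open Classical in
/-- The under-strand semiarc on the left of the crossing. -/
noncomputable def leftUnder (D : LinkDiagram) (c : D.Crossing) : D.Semiarc :=
  if D.sign c = 1 then D.out (c, Strand.lower) else D.inn (c, Strand.lower)

open Classical in
/-- The over-strand semiarc on the left of the crossing. -/
noncomputable def leftOver (D : LinkDiagram) (c : D.Crossing) : D.Semiarc :=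
  if D.sign c = 1 then D.inn (c, Strand.upper) else D.out (c, Strand.upper)

/-- Biquandle colorings of a diagram. -/
def IsColoring (D : LinkDiagram) {X : Type u} [Biquandle X] (f : D.Semiarc → X) : Prop :=
  ∀ c, f (D.leftUnder c) = f (D.rightUnder c) ▷ᵤ f (D.rightOver c) ∧
    f (D.leftOver c) = f (D.rightOver c) ▷ₒ f (D.rightUnder c)

/-- Biquandle words in the semiarcs. `underInv _ b` and `overInv _ b` are the inverses of
`_ ▷ᵤ b` and `_ ▷ₒ b`; `(sideFst a b, sideSnd a b)` is the preimage of `(a, b)` under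
`(x, y) ↦ (y ▷ₒ x, x ▷ᵤ y)`. -/
inductive Word (D : LinkDiagram) : Type
  | gen (a : D.Semiarc)
  | underOp (a b : Word D)
  | overOp (a b : Word D)
  | underInv (a b : Word D)
  | overInv (a b : Word D)
  | sideFst (a b : Word D)
  | sideSnd (a b : Word D)

open Word in
/-- The equivalence of words that is generated by the biquandle axioms and the crossing
relations. -/
inductive WordRel (D : LinkDiagram) : Word D → Word D → Prop
  | refl (a) : WordRel D a a
  | symm {a b} : WordRel D a b → WordRel D b a
  | trans {a b c} : WordRel D a b → WordRel D b c → WordRel D a c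
  | congr_under {a a' b b'} : WordRel D a a' → WordRel D b b' →
      WordRel D (underOp a b) (underOp a' b')
  | congr_over {a a' b b'} : WordRel D a a' → WordRel D b b' →
      WordRel D (overOp a b) (overOp a' b')
  | congr_underInv {a a' b b'} : WordRel D a a' → WordRel D b b' →
      WordRel D (underInv a b) (underInv a' b')
  | congr_overInv {a a' b b'} : WordRel D a a' → WordRel D b b' →
      WordRel D (overInv a b) (overInv a' b')
  | congr_sideFst {a a' b b'} : WordRel D a a' → WordRel D b b' →
      WordRel D (sideFst a b) (sideFst a' b')
  | congr_sideSnd {a a' b b'} : WordRel D a a' → WordRel D b b' →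
      WordRel D (sideSnd a b) (sideSnd a' b')
  | under_self (a) : WordRel D (underOp a a) (overOp a a)
  | under_underInv (a b) : WordRel D (underOp (underInv a b) b) a
  | underInv_under (a b) : WordRel D (underInv (underOp a b) b) a
  | over_overInv (a b) : WordRel D (overOp (overInv a b) b) a
  | overInv_over (a b) : WordRel D (overInv (overOp a b) b) a
  | side_over (a b) : WordRel D (overOp (sideSnd a b) (sideFst a b)) a
  | side_under (a b) : WordRel D (underOp (sideFst a b) (sideSnd a b)) b
  | sideFst_side (x y) : WordRel D (sideFst (overOp y x) (underOp x y)) x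
  | sideSnd_side (x y) : WordRel D (sideSnd (overOp y x) (underOp x y)) y
  | exchange_under_under (x y z) : WordRel D
      (underOp (underOp x y) (underOp z y)) (underOp (underOp x z) (overOp y z))
  | exchange_under_over (x y z) : WordRel D
      (overOp (underOp x y) (underOp z y)) (underOp (overOp x z) (overOp y z))
  | exchange_over_over (x y z) : WordRel D
      (overOp (overOp x y) (overOp z y)) (overOp (overOp x z) (underOp y z))
  | crossing_under (c : D.Crossing) : WordRel D
      (gen (D.leftUnder c)) (underOp (gen (D.rightUnder c)) (gen (D.rightOver c)))
  | crossing_over (c : D.Crossing) : WordRel D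
      (gen (D.leftOver c)) (overOp (gen (D.rightOver c)) (gen (D.rightUnder c)))

/-- Words up to equivalence. -/
def wordSetoid (D : LinkDiagram) : Setoid (Word D) where
  r := WordRel D
  iseqv := ⟨WordRel.refl, WordRel.symm, WordRel.trans⟩

/-- The fundamental biquandle of (the link represented by) a diagram. -/
def FundamentalBiquandle (D : LinkDiagram) : Type := Quotient D.wordSetoid

namespace FundamentalBiquandle

/-- The generator that belongs to a semiarc. -/
def gen {D : LinkDiagram} (a : D.Semiarc) : FundamentalBiquandle D :=
  Quotient.mk D.wordSetoid (Word.gen a)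

instance biquandle (D : LinkDiagram) : Biquandle (FundamentalBiquandle D) where
  underOp := Quotient.map₂ Word.underOp fun _ _ h _ _ h' => WordRel.congr_under h h'
  overOp := Quotient.map₂ Word.overOp fun _ _ h _ _ h' => WordRel.congr_over h h'
  under_self := by
    rintro ⟨a⟩
    exact Quotient.sound (WordRel.under_self a)
  over_bijective := by
    rintro ⟨b⟩
    refine Function.bijective_iff_has_inverse.2
      ⟨fun x => Quotient.map₂ Word.overInv
        (fun _ _ h _ _ h' => WordRel.congr_overInv h h') x (Quotient.mk D.wordSetoid b), ?_, ?_⟩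
    · rintro ⟨a⟩
      exact Quotient.sound (WordRel.overInv_over a b)
    · rintro ⟨a⟩
      exact Quotient.sound (WordRel.over_overInv a b)
  under_bijective := by
    rintro ⟨b⟩
    refine Function.bijective_iff_has_inverse.2
      ⟨fun x => Quotient.map₂ Word.underInv
        (fun _ _ h _ _ h' => WordRel.congr_underInv h h') x (Quotient.mk D.wordSetoid b), ?_, ?_⟩
    · rintro ⟨a⟩
      exact Quotient.sound (WordRel.underInv_under a b)
    · rintro ⟨a⟩
      exact Quotient.sound (WordRel.under_underInv a b)
  side_bijective := by
    refine Function.bijective_iff_has_inverse.2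
      ⟨fun p => (Quotient.map₂ Word.sideFst
          (fun _ _ h _ _ h' => WordRel.congr_sideFst h h') p.1 p.2,
        Quotient.map₂ Word.sideSnd
          (fun _ _ h _ _ h' => WordRel.congr_sideSnd h h') p.1 p.2), ?_, ?_⟩
    · rintro ⟨⟨x⟩, ⟨y⟩⟩
      exact Prod.ext (Quotient.sound (WordRel.sideFst_side x y))
        (Quotient.sound (WordRel.sideSnd_side x y))
    · rintro ⟨⟨a⟩, ⟨b⟩⟩
      exact Prod.ext (Quotient.sound (WordRel.side_over a b))
        (Quotient.sound (WordRel.side_under a b))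
  exchange_under_under := by
    rintro ⟨x⟩ ⟨y⟩ ⟨z⟩
    exact Quotient.sound (WordRel.exchange_under_under x y z)
  exchange_under_over := by
    rintro ⟨x⟩ ⟨y⟩ ⟨z⟩
    exact Quotient.sound (WordRel.exchange_under_over x y z)
  exchange_over_over := by
    rintro ⟨x⟩ ⟨y⟩ ⟨z⟩
    exact Quotient.sound (WordRel.exchange_over_over x y z)

end FundamentalBiquandle

/-- The biquandle homset `Hom(ℬ(L), X)`, computed from a diagram of `L`. -/
abbrev Homset (D : LinkDiagram) (X : Type u) [Biquandle X] : Type u :=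
  BiquandleHom (FundamentalBiquandle D) X

/-- The coloring that a homomorphism represents: the values on the semiarcs. -/
def Homset.color {D : LinkDiagram} {X : Type u} [Biquandle X] (f : D.Homset X) :
    D.Semiarc → X :=
  fun a => f.toFun (FundamentalBiquandle.gen a)

theorem Homset.isColoring {D : LinkDiagram} {X : Type u} [Biquandle X] (f : D.Homset X) :
    D.IsColoring f.color := by
  intro c
  constructor
  · exact (congrArg f.toFun (Quotient.sound (WordRel.crossing_under c))).trans
      (f.map_under (FundamentalBiquandle.gen (D.rightUnder c))
        (FundamentalBiquandle.gen (D.rightOver c)))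
  · exact (congrArg f.toFun (Quotient.sound (WordRel.crossing_over c))).trans
      (f.map_over (FundamentalBiquandle.gen (D.rightOver c))
        (FundamentalBiquandle.gen (D.rightUnder c)))

theorem Homset.color_injective {D : LinkDiagram} {X : Type u} [Biquandle X] :
    Function.Injective (Homset.color : D.Homset X → D.Semiarc → X) := by
  intro f g h
  apply BiquandleHom.toFun_injective
  funext x
  obtain ⟨a, rfl⟩ := Quotient.exists_rep x
  let B := FundamentalBiquandle D
  let m : Word D → B := Quotient.mk D.wordSetoid
  have hs : ∀ a b : Word D, f.toFun (m a) = g.toFun (m a) → f.toFun (m b) = g.toFun (m b) →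
      f.toFun (m (Word.sideFst a b)) = g.toFun (m (Word.sideFst a b)) ∧
      f.toFun (m (Word.sideSnd a b)) = g.toFun (m (Word.sideSnd a b)) := by
    intro a b ha hb
    have h1 : (m (Word.sideSnd a b) ▷ₒ m (Word.sideFst a b) : B) = m a :=
      Quotient.sound (WordRel.side_over a b)
    have h2 : (m (Word.sideFst a b) ▷ᵤ m (Word.sideSnd a b) : B) = m b :=
      Quotient.sound (WordRel.side_under a b)
    have key := (Biquandle.side_bijective (X := X)).1
      (a₁ := (f.toFun (m (Word.sideFst a b)), f.toFun (m (Word.sideSnd a b))))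
      (a₂ := (g.toFun (m (Word.sideFst a b)), g.toFun (m (Word.sideSnd a b))))
      (by
        dsimp only
        rw [← f.map_over, ← g.map_over, ← f.map_under, ← g.map_under, h1, h2, ha, hb])
    exact Prod.ext_iff.1 key
  change f.toFun (m a) = g.toFun (m a)
  induction a with
  | gen a => exact congrFun h a
  | underOp a b ha hb =>
    exact (f.map_under (m a) (m b)).trans ((by rw [ha, hb] :
      f.toFun (m a) ▷ᵤ f.toFun (m b) = g.toFun (m a) ▷ᵤ g.toFun (m b)).trans
      (g.map_under (m a) (m b)).symm)
  | overOp a b ha hb =>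
    exact (f.map_over (m a) (m b)).trans ((by rw [ha, hb] :
      f.toFun (m a) ▷ₒ f.toFun (m b) = g.toFun (m a) ▷ₒ g.toFun (m b)).trans
      (g.map_over (m a) (m b)).symm)
  | underInv a b ha hb =>
    have h1 : (m (Word.underInv a b) ▷ᵤ m b : B) = m a :=
      Quotient.sound (WordRel.under_underInv a b)
    apply (Biquandle.under_bijective (f.toFun (m b))).1
    dsimp only
    rw [← f.map_under, hb, ← g.map_under, h1, ha]
  | overInv a b ha hb =>
    have h1 : (m (Word.overInv a b) ▷ₒ m b : B) = m a :=
      Quotient.sound (WordRel.over_overInv a b)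
    apply (Biquandle.over_bijective (f.toFun (m b))).1
    dsimp only
    rw [← f.map_over, hb, ← g.map_over, h1, ha]
  | sideFst a b ha hb => exact (hs a b ha hb).1
  | sideSnd a b ha hb => exact (hs a b ha hb).2

/-- The value of a word under an assignment of elements of `X` to the semiarcs. -/
noncomputable def Word.eval {D : LinkDiagram} {X : Type u} [Biquandle X] (f : D.Semiarc → X) :
    Word D → X
  | .gen a => f a
  | .underOp a b => a.eval f ▷ᵤ b.eval f
  | .overOp a b => a.eval f ▷ₒ b.eval f
  | .underInv a b =>
    (Equiv.ofBijective _ (Biquandle.under_bijective (b.eval f))).symm (a.eval f)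
  | .overInv a b =>
    (Equiv.ofBijective _ (Biquandle.over_bijective (b.eval f))).symm (a.eval f)
  | .sideFst a b =>
    ((Equiv.ofBijective _ (Biquandle.side_bijective (X := X))).symm (a.eval f, b.eval f)).1
  | .sideSnd a b =>
    ((Equiv.ofBijective _ (Biquandle.side_bijective (X := X))).symm (a.eval f, b.eval f)).2

theorem IsColoring.eval_eq {D : LinkDiagram} {X : Type u} [Biquandle X] {f : D.Semiarc → X}
    (hf : D.IsColoring f) {a b : Word D} (h : WordRel D a b) : a.eval f = b.eval f := by
  have hs : ∀ x y : X, (Equiv.ofBijective _ (Biquandle.side_bijective (X := X)))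
      ((Equiv.ofBijective _ (Biquandle.side_bijective (X := X))).symm (x, y)) = (x, y) :=
    fun x y => Equiv.apply_symm_apply _ _
  induction h with
  | refl a => rfl
  | symm _ ih => exact ih.symm
  | trans _ _ ih ih' => exact ih.trans ih'
  | congr_under _ _ ih ih' => simp only [Word.eval, ih, ih']
  | congr_over _ _ ih ih' => simp only [Word.eval, ih, ih']
  | congr_underInv _ _ ih ih' => simp only [Word.eval, ih, ih']
  | congr_overInv _ _ ih ih' => simp only [Word.eval, ih, ih']
  | congr_sideFst _ _ ih ih' => simp only [Word.eval, ih, ih']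
  | congr_sideSnd _ _ ih ih' => simp only [Word.eval, ih, ih']
  | under_self a => exact Biquandle.under_self _
  | under_underInv a b =>
    exact Equiv.apply_symm_apply (Equiv.ofBijective _ (Biquandle.under_bijective (b.eval f))) _
  | underInv_under a b =>
    exact Equiv.symm_apply_apply (Equiv.ofBijective _ (Biquandle.under_bijective (b.eval f))) _
  | over_overInv a b =>
    exact Equiv.apply_symm_apply (Equiv.ofBijective _ (Biquandle.over_bijective (b.eval f))) _
  | overInv_over a b =>
    exact Equiv.symm_apply_apply (Equiv.ofBijective _ (Biquandle.over_bijective (b.eval f))) _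
  | side_over a b => exact congrArg Prod.fst (hs (a.eval f) (b.eval f))
  | side_under a b => exact congrArg Prod.snd (hs (a.eval f) (b.eval f))
  | sideFst_side x y =>
    exact congrArg Prod.fst (Equiv.symm_apply_apply
      (Equiv.ofBijective _ (Biquandle.side_bijective (X := X))) (x.eval f, y.eval f))
  | sideSnd_side x y =>
    exact congrArg Prod.snd (Equiv.symm_apply_apply
      (Equiv.ofBijective _ (Biquandle.side_bijective (X := X))) (x.eval f, y.eval f))
  | exchange_under_under x y z => exact Biquandle.exchange_under_under _ _ _
  | exchange_under_over x y z => exact Biquandle.exchange_under_over _ _ _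
  | exchange_over_over x y z => exact Biquandle.exchange_over_over _ _ _
  | crossing_under c => exact (hf c).1
  | crossing_over c => exact (hf c).2

/-- Every coloring is represented by a homomorphism, so that the homset is the set of colorings. -/
theorem IsColoring.exists_color_eq {D : LinkDiagram} {X : Type u} [Biquandle X]
    {f : D.Semiarc → X} (hf : D.IsColoring f) : ∃ g : D.Homset X, g.color = f :=
  ⟨{ toFun := Quotient.lift (Word.eval f) fun _ _ h => hf.eval_eq h
     map_under := by rintro ⟨a⟩ ⟨b⟩; rfl
     map_over := by rintro ⟨a⟩ ⟨b⟩; rfl }, rfl⟩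

instance Homset.finite {D : LinkDiagram} {X : Type u} [Biquandle X] [Finite X] :
    Finite (D.Homset X) :=
  Finite.of_injective _ Homset.color_injective

/-! ## The state sum of a colored diagram -/

/-- The two ways to smooth a crossing: compatibly with the orientation, or not. -/
inductive Smoothing where
  | oriented
  | disoriented
  deriving DecidableEq

instance Smoothing.fintype : Fintype Smoothing :=
  ⟨{Smoothing.oriented, Smoothing.disoriented}, by intro σ; cases σ <;> simp⟩

/-- Semiarcs that are joined by the smoothings of a state. -/
inductive Joined (D : LinkDiagram) (σ : D.Crossing → Smoothing) : D.Semiarc → D.Semiarc → Prop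
  | overUnder (c) (h : σ c = Smoothing.oriented) :
      Joined D σ (D.inn (c, Strand.upper)) (D.out (c, Strand.lower))
  | underOver (c) (h : σ c = Smoothing.oriented) :
      Joined D σ (D.inn (c, Strand.lower)) (D.out (c, Strand.upper))
  | incoming (c) (h : σ c = Smoothing.disoriented) :
      Joined D σ (D.inn (c, Strand.upper)) (D.inn (c, Strand.lower))
  | outgoing (c) (h : σ c = Smoothing.disoriented) :
      Joined D σ (D.out (c, Strand.upper)) (D.out (c, Strand.lower))

/-- The number of simple closed curves of a state. -/
noncomputable def loops (D : LinkDiagram) (σ : D.Crossing → Smoothing) : ℕ :=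
  Nat.card (Quot (D.Joined σ))

/-- The skein coefficient of a smoothing: `A x y` and `B x y` at a positive crossing, their
inverses at a negative one, where `x` and `y` are the colors of the under-strand and the
over-strand semiarc on the right of the crossing. -/
noncomputable def coeff (D : LinkDiagram) {X : Type u} {R : Type v} [Biquandle X] [CommRing R]
    (β : BiquandleBracket X R) (f : D.Semiarc → X) (c : D.Crossing) : Smoothing → Rˣ
  | Smoothing.oriented => β.A (f (D.rightUnder c)) (f (D.rightOver c)) ^ (D.sign c : ℤ)
  | Smoothing.disoriented => β.B (f (D.rightUnder c)) (f (D.rightOver c)) ^ (D.sign c : ℤ)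

/-- The number of positive crossings minus the number of negative crossings. -/
def writhe (D : LinkDiagram) : ℤ := ∑ c, (D.sign c : ℤ)

open Classical in
/-- The biquandle bracket value of a colored diagram. -/
noncomputable def bracketValue (D : LinkDiagram) {X : Type u} {R : Type v} [Biquandle X]
    [CommRing R] (β : BiquandleBracket X R) (f : D.Semiarc → X) : R :=
  ((β.w ^ (-D.writhe) : Rˣ) : R) *
    ∑ σ : D.Crossing → Smoothing, ((∏ c, D.coeff β f c (σ c) : Rˣ) : R) * β.δ ^ D.loops σ

end LinkDiagram

/-! ## Quivers and their polynomials -/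

/-- A finite quiver (directed multigraph) with weights in `W` at the vertices. -/
structure WeightedQuiver (W : Type v) where
  V : Type u
  E : Type u
  [fintypeV : Fintype V]
  [fintypeE : Fintype E]
  source : E → V
  target : E → V
  weight : V → W

namespace WeightedQuiver

attribute [instance] WeightedQuiver.fintypeV WeightedQuiver.fintypeE

/-- The number of edges that end at `v`. -/
noncomputable def inDegree {W : Type v} (Q : WeightedQuiver.{u} W) (v : Q.V) : ℕ :=
  Nat.card {e : Q.E // Q.target e = v}

/-- `∑ v, u ^ (weight of v) * v ^ (in-degree of v)`, with formal exponents in `R × ℕ`. -/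
noncomputable def inDegreePolynomial {R : Type v} [CommRing R] (Q : WeightedQuiver.{u} R) :
    AddMonoidAlgebra ℤ (R × ℕ) :=
  ∑ v, AddMonoidAlgebra.single (Q.weight v, Q.inDegree v) 1

/-- `∑ e, s ^ (weight of the source of e) * t ^ (weight of the target of e)`, with formal
exponents in `R × R`. -/
noncomputable def twoVariablePolynomial {R : Type v} [CommRing R] (Q : WeightedQuiver.{u} R) :
    AddMonoidAlgebra ℤ (R × R) :=
  ∑ e, AddMonoidAlgebra.single (Q.weight (Q.source e), Q.weight (Q.target e)) 1

end WeightedQuiver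

/-- The biquandle bracket quiver: the vertices are the elements of the homset, weighted with the
bracket values of the colorings that they represent, and every `φ ∈ S` gives one edge from each
vertex `f` to `φ ∘ f`. -/
noncomputable def LinkDiagram.bracketQuiver (D : LinkDiagram) {X : Type u} {R : Type v}
    [Biquandle X] [Finite X] [CommRing R] (β : BiquandleBracket X R)
    (S : Set (BiquandleHom X X)) : WeightedQuiver.{u} R where
  V := D.Homset X
  E := D.Homset X × S
  fintypeV := Fintype.ofFinite _
  fintypeE := Fintype.ofFinite _
  source := fun e => e.1
  target := fun e => e.2.1.comp e.1
  weight := fun f => D.bracketValue β f.color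

/-!
The quivers of two diagrams that differ by a move are isomorphic, so that their polynomials agree:
there is a bijection between the homsets that preserves the bracket values and commutes with the
endomorphisms of `X` (`LinkDiagram.SameBracketHomset`). Homomorphisms are the same as colorings,
and each move is supported in a disk. A coloring of one diagram is determined by its values
outside of the disk, and these values extend uniquely to the other diagram
(`LinkDiagram.SameBracketHomset.of_agree`). As endomorphisms of `X` act on the values, they
respect the correspondence. Planarity plays no role.

For the bracket values, the sum over the smoothings of the crossings in the disk is taken first
(`LinkDiagram.bracketValue_eq_sum`). The smoothings outside of the disk generate a relation `E`
between the semiarcs that does not involve the semiarcs inside, and the closed curves of a state are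
the classes of `E` enlarged by the pairs that are joined in the disk. It remains to compare two
local sums (`stateSum`) for a fixed `E`. Each semiarc inside of the disk is isolated for `E`, and
joining it to another one lowers the number of classes by one (`numClasses_cons_isolated`).

* First move: `A x x * δ + B x x = w`, and finiteness of `X` gives the coloring of the kink.
* Second move (`stateSum_bigon`): the two crossings have inverse coefficients, and the unwanted
  states cancel because `A / B + B / A = -δ`.
* Third move (`stateSum_triangle`): eight states on either side join the outer ends in five ways,
  which leads to five equations (`TriangleRel`). The bracket axioms are these equations for
  three positive crossings. One passes to other signs by inverting all coefficients, or by
  exchanging two crossings with the mirror images of those on the other side of the move. In terms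
  of the ratios `A / B` the five equations say that the ratios on the two sides differ by a common
  factor `u` with `u ^ 2 = 1`, by which the products of the `B`s differ as well, and that the
  ratios on one side satisfy a quadratic relation (`TriangleRel.exists_ratios`). They also force
  `2 * (u - 1) = 0` and let `u - 1` annihilate the differences of the ratios, which makes the
  relations stable under the replacements (`TriangleRatios.flip_fst`, `TriangleRatios.flip_snd`,
  `TriangleRatios.flip_trd`).
-/


/-! ### Classes of a relation enlarged by finitely many pairs -/

/-- The number of classes of the equivalence relation that is generated by `E` and by the pairs
in the list `l`. -/
noncomputable def numClasses {S : Type} (E : S → S → Prop) (l : List (S × S)) : ℕ :=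
  Nat.card (Quot fun x y => E x y ∨ (x, y) ∈ l)

/-- Two lists of pairs are interchangeable if the same functions identify the pairs. -/
theorem numClasses_congr {S : Type} {E : S → S → Prop} {l l' : List (S × S)}
    (h : ∀ {α : Type} (q : S → α), (∀ p ∈ l, q p.1 = q p.2) ↔ ∀ p ∈ l', q p.1 = q p.2) :
    numClasses E l = numClasses E l' := by
  let Q := Quot fun x y => E x y ∨ (x, y) ∈ l
  let Q' := Quot fun x y => E x y ∨ (x, y) ∈ l'
  let m : S → Q := Quot.mk _
  let m' : S → Q' := Quot.mk _
  have h₁ : ∀ x y, (E x y ∨ (x, y) ∈ l) → m' x = m' y := by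
    rintro x y (hE | hl)
    · exact Quot.sound (Or.inl hE)
    · exact (h m').2 (fun p hp => Quot.sound (Or.inr hp)) (x, y) hl
  have h₂ : ∀ x y, (E x y ∨ (x, y) ∈ l') → m x = m y := by
    rintro x y (hE | hl)
    · exact Quot.sound (Or.inl hE)
    · exact (h m).1 (fun p hp => Quot.sound (Or.inr hp)) (x, y) hl
  exact Nat.card_congr
    { toFun := Quot.lift m' h₁
      invFun := Quot.lift m h₂
      left_inv := by rintro ⟨x⟩; rfl
      right_inv := by rintro ⟨x⟩; rfl }

/-- `E` relates `m` to nothing. -/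
def IsIsolated {S : Type} (E : S → S → Prop) (m : S) : Prop :=
  ∀ x, ¬ E m x ∧ ¬ E x m

open Classical in
/-- Attaching an isolated element to another element lowers the number of classes by one. -/
theorem numClasses_cons_isolated {S : Type} [Finite S] {E : S → S → Prop} {l : List (S × S)}
    {m s : S} (hE : IsIsolated E m) (hl : ∀ p ∈ l, p.1 ≠ m ∧ p.2 ≠ m) (hs : s ≠ m) :
    numClasses E ((m, s) :: l) + 1 = numClasses E l := by
  let Q := Quot fun x y => E x y ∨ (x, y) ∈ l
  let Q' := Quot fun x y => E x y ∨ (x, y) ∈ (m, s) :: l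
  let f : S → Option Q' := fun x => if x = m then none else some (Quot.mk _ x)
  let g : S → Q := fun x => Quot.mk _ (if x = m then s else x)
  have hne : ∀ x y, (E x y ∨ (x, y) ∈ l) → x ≠ m ∧ y ≠ m := by
    rintro x y (h | h)
    · exact ⟨fun hx => (hE y).1 (hx ▸ h), fun hy => (hE x).2 (hy ▸ h)⟩
    · exact hl _ h
  have hf : ∀ x y, (E x y ∨ (x, y) ∈ l) → f x = f y := by
    intro x y h
    obtain ⟨hx, hy⟩ := hne x y h
    simp only [f, if_neg hx, if_neg hy]
    exact congrArg some (Quot.sound (h.imp_right (List.mem_cons_of_mem _)))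
  have hg : ∀ x y, (E x y ∨ (x, y) ∈ (m, s) :: l) → g x = g y := by
    intro x y h
    rw [List.mem_cons, or_left_comm] at h
    rcases h with h | h
    · obtain ⟨rfl, rfl⟩ := Prod.ext_iff.1 h
      simp [g]
    · obtain ⟨hx, hy⟩ := hne x y h
      simp only [g, if_neg hx, if_neg hy]
      exact Quot.sound h
  have e : Q ≃ Option Q' :=
    { toFun := Quot.lift f hf
      invFun := fun o => o.elim (Quot.mk _ m) (Quot.lift g hg)
      left_inv := by
        rintro ⟨x⟩
        by_cases hx : x = m <;> simp [f, g, hx]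
      right_inv := by
        rintro (_ | q)
        · simp [f]
        · induction q using Quot.ind with | _ x
          by_cases hx : x = m
          · subst hx
            simp only [Option.elim, g, f, if_pos, if_neg hs]
            have h : (Quot.mk _ x : Q') = Quot.mk _ s := Quot.sound (Or.inr List.mem_cons_self)
            exact congrArg some h.symm
          · simp [f, g, hx] }
  have : numClasses E l = Nat.card (Option Q') := Nat.card_congr e
  rw [this, Finite.card_option]
  rfl

/-! ### Local state sums -/

/-- The two ways to resolve a crossing, each with a coefficient and with the pairs of ends that it
joins. -/
structure Resolution (R : Type v) (S : Type) where
  fstCoeff : R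
  sndCoeff : R
  fstPairs : List (S × S)
  sndPairs : List (S × S)

/-- The sum over all resolutions of the crossings in a list of the product of the coefficients
times `δ` to the number of closed curves, where `E` is the effect of the remaining crossings and
`l` lists additional joined pairs. -/
noncomputable def stateSum {R : Type v} [CommRing R] {S : Type} (δ : R) (E : S → S → Prop) :
    List (Resolution R S) → List (S × S) → R
  | [], l => δ ^ numClasses E l
  | r :: rs, l => r.fstCoeff * stateSum δ E rs (r.fstPairs ++ l) +
      r.sndCoeff * stateSum δ E rs (r.sndPairs ++ l)

/-- A crossing of a strand with ends `u₀`, `u₁` over a strand with ends `v₀`, `v₁`, where `u₀` and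
`v₀` are adjacent. The first resolution joins `u₀` to `v₁`, the second one joins it to `v₀`. -/
def crossingResolution {R : Type v} {S : Type} (a b : R) (u₀ u₁ v₀ v₁ : S) : Resolution R S :=
  ⟨a, b, [(u₀, v₁), (u₁, v₀)], [(u₀, v₀), (u₁, v₁)]⟩

section StateSum

variable {R : Type v} [CommRing R] {S : Type} {δ : R} {E : S → S → Prop}

/-- The state sum of a bigon in which two strands cross twice, with inverse coefficients. -/
theorem stateSum_bigon [Finite S] {a b : Rˣ}
    (hδ : (((a⁻¹ * b : Rˣ) : R) + ((a * b⁻¹ : Rˣ) : R)) = -δ)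
    {u₀ u₁ u₂ v₀ v₁ v₂ : S} (hu : IsIsolated E u₁) (hv : IsIsolated E v₁) (huv : u₁ ≠ v₁)
    (hu₀ : u₀ ≠ u₁ ∧ u₀ ≠ v₁) (hu₂ : u₂ ≠ u₁ ∧ u₂ ≠ v₁)
    (hv₀ : v₀ ≠ u₁ ∧ v₀ ≠ v₁) (hv₂ : v₂ ≠ u₁ ∧ v₂ ≠ v₁) :
    stateSum δ E [crossingResolution (a : R) b u₀ u₁ v₀ v₁,
      crossingResolution ((a⁻¹ : Rˣ) : R) ((b⁻¹ : Rˣ) : R) u₂ u₁ v₂ v₁] [] =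
      δ ^ numClasses E [(u₀, u₁), (u₁, u₂), (v₀, v₁), (v₁, v₂)] := by
  have reduce : ∀ l : List (S × S), (∀ p ∈ l, p.1 ≠ u₁ ∧ p.2 ≠ u₁) →
      (∀ p ∈ l, p.1 ≠ v₁ ∧ p.2 ≠ v₁) → ∀ s, s ≠ u₁ → s ≠ v₁ → ∀ t, t ≠ v₁ →
      numClasses E ((v₁, t) :: (u₁, s) :: l) + 2 = numClasses E l := by
    intro l h₁ h₂ s hs hs' t ht
    rw [← numClasses_cons_isolated hu h₁ hs,
      ← numClasses_cons_isolated hv (l := (u₁, s) :: l) _ ht]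
    rintro p hp
    rcases List.mem_cons.1 hp with rfl | hp
    · exact ⟨huv, hs'⟩
    · exact h₂ p hp
  have hP := reduce [(u₀, u₂), (v₀, v₂)] (by simp [*]) (by simp [*]) u₀ hu₀.1 hu₀.2 v₀ hv₀.2
  have hP' := reduce [(u₀, u₂), (v₀, v₂)] (by simp [*]) (by simp [*]) v₀ hv₀.1 hv₀.2 u₀ hu₀.2
  have hQ := reduce [(u₀, v₀), (u₂, v₂)] (by simp [*]) (by simp [*]) u₀ hu₀.1 hu₀.2 v₀ hv₀.2
  have hQ' := reduce [(u₀, v₀), (u₂, v₂)] (by simp [*]) (by simp [*]) u₂ hu₂.1 hu₂.2 v₂ hv₂.2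
  have hloop := numClasses_cons_isolated hv (l := [(u₀, v₀), (u₂, v₂)]) (by simp [*]) huv
  have e₁ : numClasses E [(v₁, v₀), (u₁, u₀), (u₀, u₂), (v₀, v₂)] =
      numClasses E [(u₀, u₁), (u₁, u₂), (v₀, v₁), (v₁, v₂)] :=
    numClasses_congr fun q => by simp; grind
  have e₂ : numClasses E [(u₂, v₁), (u₁, v₂), (u₀, v₁), (u₁, v₀)] =
      numClasses E [(v₁, u₀), (u₁, v₀), (u₀, u₂), (v₀, v₂)] :=
    numClasses_congr fun q => by simp; grind
  have e₃ : numClasses E [(u₂, v₁), (u₁, v₂), (u₀, v₀), (u₁, v₁)] =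
      numClasses E [(v₁, v₂), (u₁, u₂), (u₀, v₀), (u₂, v₂)] :=
    numClasses_congr fun q => by simp; grind
  have e₄ : numClasses E [(u₂, v₂), (u₁, v₁), (u₀, v₁), (u₁, v₀)] =
      numClasses E [(v₁, v₀), (u₁, u₀), (u₀, v₀), (u₂, v₂)] :=
    numClasses_congr fun q => by simp; grind
  have e₅ : numClasses E [(u₂, v₂), (u₁, v₁), (u₀, v₀), (u₁, v₁)] =
      numClasses E [(v₁, u₁), (u₀, v₀), (u₂, v₂)] :=
    numClasses_congr fun q => by simp; grind
  simp only [stateSum, crossingResolution, List.cons_append, List.nil_append]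
  rw [e₂, e₃, e₄, e₅, ← e₁]
  generalize numClasses E [(v₁, v₀), (u₁, u₀), (u₀, u₂), (v₀, v₂)] = nP at *
  have h₃ : numClasses E [(v₁, v₂), (u₁, u₂), (u₀, v₀), (u₂, v₂)] =
    numClasses E [(v₁, v₀), (u₁, u₀), (u₀, v₀), (u₂, v₂)] := by omega
  have h₄ : numClasses E [(v₁, u₁), (u₀, v₀), (u₂, v₂)] =
    numClasses E [(v₁, v₀), (u₁, u₀), (u₀, v₀), (u₂, v₂)] + 1 := by omega
  have h₅ : numClasses E [(v₁, u₀), (u₁, v₀), (u₀, u₂), (v₀, v₂)] = nP := by omega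
  rw [h₃, h₄, h₅, pow_succ]
  push_cast at hδ
  linear_combination δ ^ nP * a.mul_inv +
    δ * δ ^ numClasses E [(v₁, v₀), (u₁, u₀), (u₀, v₀), (u₂, v₂)] * b.mul_inv +
    δ ^ numClasses E [(v₁, v₀), (u₁, u₀), (u₀, v₀), (u₂, v₂)] * hδ

/-- Of the eight states of a triangle, whose sides are `u₁`, `v₁`, `w₁`, four join the six outer
ends in the same way, one of them with an additional closed curve; the other four join the outer
ends in four further ways. The differences do not truncate: `numClasses` on the right counts each of
`u₁`, `v₁`, `w₁` as a class of its own. -/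
theorem stateSum_triangle [Finite S] (ap bp aq bq ar br : R) {u₀ u₁ u₂ v₀ v₁ v₂ w₀ w₁ w₂ : S}
    (hu : IsIsolated E u₁) (hv : IsIsolated E v₁) (hw : IsIsolated E w₁)
    (huv : u₁ ≠ v₁) (huw : u₁ ≠ w₁) (hvw : v₁ ≠ w₁)
    (hu₀ : u₀ ≠ u₁ ∧ u₀ ≠ v₁ ∧ u₀ ≠ w₁) (hu₂ : u₂ ≠ u₁ ∧ u₂ ≠ v₁ ∧ u₂ ≠ w₁)
    (hv₀ : v₀ ≠ u₁ ∧ v₀ ≠ v₁ ∧ v₀ ≠ w₁) (hv₂ : v₂ ≠ u₁ ∧ v₂ ≠ v₁ ∧ v₂ ≠ w₁)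
    (hw₀ : w₀ ≠ u₁ ∧ w₀ ≠ v₁ ∧ w₀ ≠ w₁) (hw₂ : w₂ ≠ u₁ ∧ w₂ ≠ v₁ ∧ w₂ ≠ w₁) :
    stateSum δ E [crossingResolution ap bp u₀ u₁ v₀ v₁, crossingResolution aq bq u₁ u₂ w₀ w₁,
      crossingResolution ar br v₁ v₂ w₁ w₂] [] =
      ap * aq * ar * δ ^ (numClasses E [(u₀, w₂), (v₀, v₂), (u₂, w₀)] - 3) +
      (ap * aq * br + bp * aq * ar + δ * bp * aq * br + bp * bq * br) *
        δ ^ (numClasses E [(u₀, v₀), (u₂, w₀), (v₂, w₂)] - 3) +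
      ap * bq * ar * δ ^ (numClasses E [(u₀, w₂), (v₀, w₀), (u₂, v₂)] - 3) +
      ap * bq * br * δ ^ (numClasses E [(u₀, u₂), (v₀, w₀), (v₂, w₂)] - 3) +
      bp * bq * ar * δ ^ (numClasses E [(u₀, v₀), (w₀, w₂), (u₂, v₂)] - 3) := by
  have reduce : ∀ l : List (S × S), (∀ p ∈ l, p.1 ≠ u₁ ∧ p.2 ≠ u₁) →
      (∀ p ∈ l, p.1 ≠ v₁ ∧ p.2 ≠ v₁) → (∀ p ∈ l, p.1 ≠ w₁ ∧ p.2 ≠ w₁) →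
      ∀ r s t, r ≠ u₁ → r ≠ v₁ → r ≠ w₁ → s ≠ v₁ → s ≠ w₁ → t ≠ w₁ →
      numClasses E ((w₁, t) :: (v₁, s) :: (u₁, r) :: l) + 3 = numClasses E l := by
    intro l h₁ h₂ h₃ r s t hr hr' hr'' hs hs' ht
    rw [← numClasses_cons_isolated hu h₁ hr,
      ← numClasses_cons_isolated hv (l := (u₁, r) :: l) _ hs,
      ← numClasses_cons_isolated hw (l := (v₁, s) :: (u₁, r) :: l) _ ht]
    · rintro p hp
      rcases List.mem_cons.1 hp with rfl | hp
      · exact ⟨hvw, hs'⟩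
      rcases List.mem_cons.1 hp with rfl | hp
      · exact ⟨huw, hr''⟩
      · exact h₃ p hp
    · rintro p hp
      rcases List.mem_cons.1 hp with rfl | hp
      · exact ⟨huv, hr'⟩
      · exact h₂ p hp
  have ccc := reduce [(u₀, w₂), (v₀, v₂), (u₂, w₀)] (by simp [*]) (by simp [*]) (by simp [*])
    v₀ u₀ v₀ (by simp [*]) (by simp [*]) (by simp [*]) (by simp [*]) (by simp [*]) (by simp [*])
  have ccp := reduce [(u₀, v₀), (u₂, w₀), (v₂, w₂)] (by simp [*]) (by simp [*]) (by simp [*])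
    u₀ u₀ u₀ (by simp [*]) (by simp [*]) (by simp [*]) (by simp [*]) (by simp [*]) (by simp [*])
  have pcc := reduce [(u₀, v₀), (u₂, w₀), (v₂, w₂)] (by simp [*]) (by simp [*]) (by simp [*])
    v₂ v₂ v₂ (by simp [*]) (by simp [*]) (by simp [*]) (by simp [*]) (by simp [*]) (by simp [*])
  have ppp := reduce [(u₀, v₀), (u₂, w₀), (v₂, w₂)] (by simp [*]) (by simp [*]) (by simp [*])
    w₀ w₀ w₀ (by simp [*]) (by simp [*]) (by simp [*]) (by simp [*]) (by simp [*]) (by simp [*])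
  have cpc := reduce [(u₀, w₂), (v₀, w₀), (u₂, v₂)] (by simp [*]) (by simp [*]) (by simp [*])
    v₀ u₀ v₂ (by simp [*]) (by simp [*]) (by simp [*]) (by simp [*]) (by simp [*]) (by simp [*])
  have cpp := reduce [(u₀, u₂), (v₀, w₀), (v₂, w₂)] (by simp [*]) (by simp [*]) (by simp [*])
    v₀ u₀ u₀ (by simp [*]) (by simp [*]) (by simp [*]) (by simp [*]) (by simp [*]) (by simp [*])
  have ppc := reduce [(u₀, v₀), (w₀, w₂), (u₂, v₂)] (by simp [*]) (by simp [*]) (by simp [*])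
    w₀ w₀ v₂ (by simp [*]) (by simp [*]) (by simp [*]) (by simp [*]) (by simp [*]) (by simp [*])
  -- In the remaining state the sides of the triangle form a closed curve.
  have pcp : numClasses E [(w₁, v₁), (v₁, u₁), (u₀, v₀), (u₂, w₀), (v₂, w₂)] + 2 =
      numClasses E [(u₀, v₀), (u₂, w₀), (v₂, w₂)] := by
    rw [← numClasses_cons_isolated hv (l := [(u₀, v₀), (u₂, w₀), (v₂, w₂)]) (by simp [*]) huv,
      ← numClasses_cons_isolated hw (l := [(v₁, u₁), (u₀, v₀), (u₂, w₀), (v₂, w₂)])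
      (by simp [*]) hvw]
  simp only [stateSum, crossingResolution, List.cons_append, List.nil_append]
  have eccc : numClasses E [(v₁, w₂), (v₂, w₁), (u₁, w₁), (u₂, w₀), (u₀, v₁), (u₁, v₀)] =
      numClasses E [(w₁, v₀), (v₁, u₀), (u₁, v₀), (u₀, w₂), (v₀, v₂), (u₂, w₀)] :=
    numClasses_congr fun q => by simp; grind
  have eccp : numClasses E [(v₁, w₁), (v₂, w₂), (u₁, w₁), (u₂, w₀), (u₀, v₁), (u₁, v₀)] =
      numClasses E [(w₁, u₀), (v₁, u₀), (u₁, u₀), (u₀, v₀), (u₂, w₀), (v₂, w₂)] :=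
    numClasses_congr fun q => by simp; grind
  have ecpc : numClasses E [(v₁, w₂), (v₂, w₁), (u₁, w₀), (u₂, w₁), (u₀, v₁), (u₁, v₀)] =
      numClasses E [(w₁, v₂), (v₁, u₀), (u₁, v₀), (u₀, w₂), (v₀, w₀), (u₂, v₂)] :=
    numClasses_congr fun q => by simp; grind
  have ecpp : numClasses E [(v₁, w₁), (v₂, w₂), (u₁, w₀), (u₂, w₁), (u₀, v₁), (u₁, v₀)] =
      numClasses E [(w₁, u₀), (v₁, u₀), (u₁, v₀), (u₀, u₂), (v₀, w₀), (v₂, w₂)] :=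
    numClasses_congr fun q => by simp; grind
  have epcc : numClasses E [(v₁, w₂), (v₂, w₁), (u₁, w₁), (u₂, w₀), (u₀, v₀), (u₁, v₁)] =
      numClasses E [(w₁, v₂), (v₁, v₂), (u₁, v₂), (u₀, v₀), (u₂, w₀), (v₂, w₂)] :=
    numClasses_congr fun q => by simp; grind
  have epcp : numClasses E [(v₁, w₁), (v₂, w₂), (u₁, w₁), (u₂, w₀), (u₀, v₀), (u₁, v₁)] =
      numClasses E [(w₁, v₁), (v₁, u₁), (u₀, v₀), (u₂, w₀), (v₂, w₂)] :=
    numClasses_congr fun q => by simp; grind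
  have eppc : numClasses E [(v₁, w₂), (v₂, w₁), (u₁, w₀), (u₂, w₁), (u₀, v₀), (u₁, v₁)] =
      numClasses E [(w₁, v₂), (v₁, w₀), (u₁, w₀), (u₀, v₀), (w₀, w₂), (u₂, v₂)] :=
    numClasses_congr fun q => by simp; grind
  have eppp : numClasses E [(v₁, w₁), (v₂, w₂), (u₁, w₀), (u₂, w₁), (u₀, v₀), (u₁, v₁)] =
      numClasses E [(w₁, w₀), (v₁, w₀), (u₁, w₀), (u₀, v₀), (u₂, w₀), (v₂, w₂)] :=
    numClasses_congr fun q => by simp; grind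
  rw [eccc, eccp, ecpc, ecpp, epcc, epcp, eppc, eppp, Nat.eq_sub_of_add_eq ccc,
    Nat.eq_sub_of_add_eq ccp, Nat.eq_sub_of_add_eq cpc, Nat.eq_sub_of_add_eq cpp,
    Nat.eq_sub_of_add_eq pcc, Nat.eq_sub_of_add_eq ppc, Nat.eq_sub_of_add_eq ppp,
    show numClasses E [(w₁, v₁), (v₁, u₁), (u₀, v₀), (u₂, w₀), (v₂, w₂)] =
      numClasses E [(u₀, v₀), (u₂, w₀), (v₂, w₂)] - 3 + 1 by omega, pow_succ]
  ring

end StateSum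

/-! ### The algebra of the third Reidemeister move -/

section Triangle

variable {R : Type v} [CommRing R]

/-- The ratio of the two coefficients of a crossing. -/
def ratio (P : Rˣ × Rˣ) : Rˣ := P.1 * P.2⁻¹

theorem ratio_mul (P : Rˣ × Rˣ) : ratio P * P.2 = P.1 := by simp [ratio]

theorem ratio_inv (P : Rˣ × Rˣ) : ratio P⁻¹ = (ratio P)⁻¹ := by simp [ratio, mul_comm]

theorem ratio_swap_inv (P : Rˣ × Rˣ) : ratio P.swap⁻¹ = ratio P := by simp [ratio, mul_comm]

/-- The coefficients of a crossing are compatible with the value `δ` of a closed curve. -/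
def IsSkein (δ : R) (P : Rˣ × Rˣ) : Prop :=
  (ratio P : R) + ((ratio P)⁻¹ : Rˣ) = -δ

theorem IsSkein.inv {δ : R} {P : Rˣ × Rˣ} (h : IsSkein δ P) : IsSkein δ P⁻¹ := by
  unfold IsSkein at *
  rw [ratio_inv, inv_inv, add_comm]
  exact h

theorem IsSkein.swap_inv {δ : R} {P : Rˣ × Rˣ} (h : IsSkein δ P) : IsSkein δ P.swap⁻¹ := by
  unfold IsSkein at *
  rw [ratio_swap_inv]
  exact h

/-- The equations between the coefficients of the crossings of two triangles that make their
state sums equal. -/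
def TriangleRel (δ : R) (p q r p' q' r' : Rˣ × Rˣ) : Prop :=
  (p.1 * q.1 * r.1 : R) = p'.1 * q'.1 * r'.1 ∧
  (p.1 * q.2 * r.2 : R) = p'.1 * q'.2 * r'.2 ∧
  (p.2 * q.2 * r.1 : R) = p'.2 * q'.2 * r'.1 ∧
  (p.1 * q.1 * r.2 + p.2 * q.1 * r.1 + δ * p.2 * q.1 * r.2 + p.2 * q.2 * r.2 : R) =
    p'.1 * q'.2 * r'.1 ∧
  (p.1 * q.2 * r.1 : R) =
    p'.1 * q'.1 * r'.2 + p'.2 * q'.1 * r'.1 + δ * p'.2 * q'.1 * r'.2 + p'.2 * q'.2 * r'.2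

/-- The consequences of `TriangleRel` for the ratios of the coefficients. `TriangleRatios` is
preserved if two of the crossings are exchanged with the mirror images of those on the other side,
see `TriangleRatios.flip_fst`. In this way one oriented version of the third Reidemeister move
leads to the others. -/
structure TriangleRatios (δ : R) (p q r p' q' r' : Rˣ × Rˣ) (u : Rˣ) : Prop where
  skein : IsSkein δ p ∧ IsSkein δ q ∧ IsSkein δ r ∧ IsSkein δ p' ∧ IsSkein δ q' ∧ IsSkein δ r'
  sq : u * u = 1
  fst : ratio p' = u * ratio p
  snd : ratio q' = u * ratio q
  trd : ratio r' = u * ratio r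
  prod : p.2 * q.2 * r.2 = u * (p'.2 * q'.2 * r'.2)
  two : 2 * ((u : R) - 1) = 0
  fst_snd : ((u : R) - 1) * ratio q = (u - 1) * ratio p
  fst_trd : ((u : R) - 1) * ratio r = (u - 1) * ratio p
  rel : (ratio q * (ratio p + ratio r) : R) = u * ratio p * ratio r + ratio q ^ 2

/-- The arithmetic behind `TriangleRel.exists_ratios`, for the ratios `p`, `q`, `r` of one
triangle and the ratios `u * p`, `q'`, `u * r` of the other. -/
theorem ratios_arithmetic {δ : R} {p q r q' u : Rˣ} (hp : (p : R) + (p⁻¹ : Rˣ) = -δ)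
    (hq : (q : R) + (q⁻¹ : Rˣ) = -δ) (hr : (r : R) + (r⁻¹ : Rˣ) = -δ)
    (hp' : ((u * p : Rˣ) : R) + ((u * p)⁻¹ : Rˣ) = -δ) (hqq : q = u * q')
    (hrel : (q * (p + r) : R) = u * p * r + q ^ 2)
    (hrel' : (u * p * r : R) = q' * (u * p + u * r - q')) :
    u * u = 1 ∧ 2 * ((u : R) - 1) = 0 ∧ ((u : R) - 1) * q = (u - 1) * p ∧
      ((u : R) - 1) * r = (u - 1) * p := by
  have hsq : u * u = 1 := by
    apply mul_right_cancel (b := q * q)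
    ext
    have hqq := congrArg Units.val hqq
    push_cast at *
    linear_combination (-u ^ 2 : R) * hrel - (u ^ 2 : R) * hrel' +
      (u ^ 2 * (p + r) - q - u * q' : R) * hqq
  have hu := congrArg Units.val hsq
  have hpq : ((p : R) - q) * (p * q - 1) = 0 := by
    linear_combination (p * q : R) * (hp - hq) - (q : R) * p.mul_inv + (p : R) * q.mul_inv
  have hrq : ((r : R) - q) * (r * q - 1) = 0 := by
    linear_combination (r * q : R) * (hr - hq) - (q : R) * r.mul_inv + (r : R) * q.mul_inv
  have hup : ((u : R) - 1) * (p ^ 2 + 1) = 0 := by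
    rw [mul_inv, inv_eq_of_mul_eq_one_left hsq] at hp'
    push_cast at hp' hu
    linear_combination (p : R) * (hp' - hp) - ((u : R) - 1) * p.mul_inv
  push_cast at hu
  have hvpq : ((u : R) - 1) * (p * q - 1) = 0 := by
    apply (p * r).isUnit.mul_left_cancel
    push_cast
    linear_combination (1 - p * q : R) * hrel - (r - q : R) * hpq
  have hvrq : ((u : R) - 1) * (r * q - 1) = 0 := by
    apply (p * r).isUnit.mul_left_cancel
    push_cast
    linear_combination (1 - r * q : R) * hrel - (p - q : R) * hrq
  have hq_neg : ((u : R) - 1) * q = -((u - 1) * p) := by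
    linear_combination (q : R) * hup - (p : R) * hvpq
  have hr_neg : ((u : R) - 1) * r = (u - 1) * p := by
    apply q.isUnit.mul_left_cancel
    linear_combination hvrq - hvpq
  have htwo : 2 * ((u : R) - 1) = 0 := by
    linear_combination (u - 1 : R) * hrel - 2 * hvpq - hvrq + (q : R) * hq_neg +
      (u * p : R) * hr_neg + (u : R) * hup - hu
  refine ⟨hsq, htwo, ?_, hr_neg⟩
  linear_combination hq_neg - (p : R) * htwo

theorem TriangleRel.exists_ratios {δ : R} {p q r p' q' r' : Rˣ × Rˣ}
    (h : TriangleRel δ p q r p' q' r') (hp : IsSkein δ p) (hq : IsSkein δ q) (hr : IsSkein δ r)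
    (hp' : IsSkein δ p') (hq' : IsSkein δ q') (hr' : IsSkein δ r') :
    ∃ u, TriangleRatios δ p q r p' q' r' u := by
  obtain ⟨h₁, h₂, h₃, h₄, h₅⟩ := h
  simp only [← ratio_mul] at h₁ h₂ h₃ h₄ h₅
  have hprod : ∃ u : Rˣ, p.2 * q.2 * r.2 = u * (p'.2 * q'.2 * r'.2) :=
    ⟨p.2 * q.2 * r.2 * (p'.2 * q'.2 * r'.2)⁻¹, (inv_mul_cancel_right _ _).symm⟩
  obtain ⟨u, hprod⟩ := hprod
  have hu := congrArg Units.val hprod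
  have hfst : ratio p' = u * ratio p := by
    apply mul_right_cancel (b := p'.2 * q'.2 * r'.2)
    ext
    push_cast at *
    linear_combination (ratio p : R) * hu - h₂
  have htrd : ratio r' = u * ratio r := by
    apply mul_right_cancel (b := p'.2 * q'.2 * r'.2)
    ext
    push_cast at *
    linear_combination (ratio r : R) * hu - h₃
  have hf := congrArg Units.val hfst
  have ht := congrArg Units.val htrd
  push_cast at h₁ h₂ h₃ h₄ h₅ hu hf ht
  rw [hf, ht] at h₁ h₄ h₅
  have hsnd : ratio q = u * ratio q' := by
    apply mul_right_cancel (b := p'.2 * q'.2 * r'.2 * (ratio p * ratio r * u))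
    ext
    push_cast
    linear_combination h₁ - (ratio p * ratio q * ratio r : R) * hu
  have hrel : (ratio q * (ratio p + ratio r) : R) = u * ratio p * ratio r + ratio q ^ 2 := by
    apply (p'.2 * q'.2 * r'.2 * u).isUnit.mul_left_cancel
    unfold IsSkein at hq
    push_cast
    linear_combination h₄ - (ratio p * ratio q + ratio q * ratio r - ratio q ^ 2 : R) * hu -
      (p.2 * q.2 * r.2 : R) * (ratio q * hq - (ratio q).mul_inv)
  have hrel' : (u * ratio p * ratio r : R) =
      ratio q' * (u * ratio p + u * ratio r - ratio q') := by
    apply (p'.2 * q'.2 * r'.2).isUnit.mul_left_cancel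
    unfold IsSkein at hq'
    push_cast
    linear_combination h₅ - (ratio p * ratio r : R) * hu +
      (p'.2 * q'.2 * r'.2 : R) * (ratio q' * hq' - (ratio q').mul_inv)
  obtain ⟨hsq, htwo, hpq, hpr⟩ :=
    ratios_arithmetic hp hq hr (hfst ▸ hp') hsnd hrel hrel'
  refine ⟨u, ⟨hp, hq, hr, hp', hq', hr'⟩, hsq, hfst, ?_, htrd, hprod, htwo, hpq, hpr, hrel⟩
  rw [hsnd, ← mul_assoc, hsq, one_mul]

/-- Cross-multiplication of a product with two inverted factors. -/
theorem mul_inv_mul_inv_eq {G : Type*} [CommGroup G] {x y z x' y' z' u : G}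
    (h : x * (y * z) = u * (x' * (y' * z'))) : x * y'⁻¹ * z'⁻¹ = u * x' * y⁻¹ * z⁻¹ := by
  rw [mul_assoc, mul_assoc _ y⁻¹, ← mul_inv, ← mul_inv, mul_inv_eq_iff_eq_mul,
    mul_right_comm, eq_mul_inv_iff_mul_eq, h, mul_assoc]

namespace TriangleRatios

variable {δ : R} {p q r p' q' r' : Rˣ × Rˣ} {u : Rˣ}

theorem triangleRel (h : TriangleRatios δ p q r p' q' r' u) : TriangleRel δ p q r p' q' r' := by
  have hu := congrArg Units.val h.prod
  have hsq := congrArg Units.val h.sq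
  have hf := congrArg Units.val h.fst
  have hs := congrArg Units.val h.snd
  have ht := congrArg Units.val h.trd
  have hq : _ = _ := h.skein.2.1
  have hq' : _ = _ := h.skein.2.2.2.2.1
  have hrel := h.rel
  unfold TriangleRel
  simp only [← ratio_mul]
  push_cast at *
  refine ⟨?_, ?_, ?_, ?_, ?_⟩
  · rw [hf, hs, ht]
    linear_combination (ratio p * ratio q * ratio r : R) * hu -
      (u * p'.2 * q'.2 * r'.2 * ratio p * ratio q * ratio r : R) * hsq
  · rw [hf]
    linear_combination (ratio p : R) * hu
  · rw [ht]
    linear_combination (ratio r : R) * hu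
  · rw [hf, ht]
    linear_combination (ratio p * ratio q + ratio q * ratio r - ratio q ^ 2 : R) * hu +
      (p.2 * q.2 * r.2 : R) * (ratio q * hq - (ratio q).mul_inv) +
      (u * p'.2 * q'.2 * r'.2 : R) * hrel
  · rw [hf, ht]
    have hrel' : (u * ratio p * ratio r : R) =
        ratio q' * (u * ratio p + u * ratio r - ratio q') := by
      rw [hs]
      linear_combination -hrel - (ratio q * (ratio p + ratio r) - ratio q ^ 2 : R) * hsq
    linear_combination (ratio p * ratio r : R) * hu +
      (p'.2 * q'.2 * r'.2 : R) * hrel' -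
      (p'.2 * q'.2 * r'.2 : R) * (ratio q' * hq' - (ratio q').mul_inv)

theorem symm (h : TriangleRatios δ p q r p' q' r' u) : TriangleRatios δ p' q' r' p q r u := by
  have key : ∀ a b : Rˣ, a = u * b → b = u * a := fun a b hab => by
    rw [hab, ← mul_assoc, h.sq, one_mul]
  have hsq := congrArg Units.val h.sq
  have hrel := h.rel
  have h₁ := h.fst_snd
  have h₂ := h.fst_trd
  push_cast at hsq
  refine ⟨⟨h.skein.2.2.2.1, h.skein.2.2.2.2.1, h.skein.2.2.2.2.2, h.skein.1, h.skein.2.1,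
    h.skein.2.2.1⟩, h.sq, key _ _ h.fst, key _ _ h.snd, key _ _ h.trd, key _ _ h.prod, h.two,
    ?_, ?_, ?_⟩
  · rw [h.fst, h.snd]
    push_cast
    linear_combination (u : R) * h₁
  · rw [h.fst, h.trd]
    push_cast
    linear_combination (u : R) * h₂
  · rw [h.fst, h.snd, h.trd]
    push_cast
    linear_combination (u ^ 2 : R) * hrel

theorem inv (h : TriangleRatios δ p q r p' q' r' u) :
    TriangleRatios δ p⁻¹ q⁻¹ r⁻¹ p'⁻¹ q'⁻¹ r'⁻¹ u := by
  have hui : u⁻¹ = u := inv_eq_of_mul_eq_one_left h.sq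
  have hrel := h.rel
  have h₁ := h.fst_snd
  have h₂ := h.fst_trd
  have hp := (ratio p).mul_inv
  have hq := (ratio q).mul_inv
  have hr := (ratio r).mul_inv
  refine ⟨⟨h.skein.1.inv, h.skein.2.1.inv, h.skein.2.2.1.inv, h.skein.2.2.2.1.inv,
    h.skein.2.2.2.2.1.inv, h.skein.2.2.2.2.2.inv⟩, h.sq, ?_, ?_, ?_, ?_, h.two, ?_, ?_, ?_⟩
  · rw [ratio_inv, ratio_inv, h.fst, mul_inv, hui]
  · rw [ratio_inv, ratio_inv, h.snd, mul_inv, hui]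
  · rw [ratio_inv, ratio_inv, h.trd, mul_inv, hui]
  · simp only [Prod.snd_inv, ← mul_inv, h.prod]
    rw [mul_inv, hui]
  · rw [ratio_inv, ratio_inv]
    generalize (ratio p)⁻¹ = p₁ at *
    generalize (ratio q)⁻¹ = q₁ at *
    grind
  · rw [ratio_inv, ratio_inv]
    generalize (ratio p)⁻¹ = p₁ at *
    generalize (ratio r)⁻¹ = r₁ at *
    grind
  · rw [ratio_inv, ratio_inv, ratio_inv]
    generalize (ratio p)⁻¹ = p₁ at *
    generalize (ratio q)⁻¹ = q₁ at *
    generalize (ratio r)⁻¹ = r₁ at *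
    grind

/-- Crossings of opposite sign at the second and third vertex: their coefficients are exchanged
with those on the other side and inverted. -/
theorem flip_fst (h : TriangleRatios δ p q r p' q' r' u) :
    TriangleRatios δ p q'.swap⁻¹ r'.swap⁻¹ p' q.swap⁻¹ r.swap⁻¹ u := by
  have h₁ := h.fst_snd
  have h₂ := h.fst_trd
  have htwo := h.two
  have hrel := h.rel
  have hsq := congrArg Units.val h.sq
  have hprod := congrArg Units.val h.prod
  push_cast at hsq hprod
  refine ⟨⟨h.skein.1, h.skein.2.2.2.2.1.swap_inv, h.skein.2.2.2.2.2.swap_inv, h.skein.2.2.2.1,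
    h.skein.2.1.swap_inv, h.skein.2.2.1.swap_inv⟩, h.sq, ?_, ?_, ?_, ?_, h.two, ?_, ?_, ?_⟩ <;>
    simp only [ratio_swap_inv, Prod.snd_inv, Prod.snd_swap, h.fst, h.snd, h.trd, ← mul_assoc,
      h.sq, one_mul, Units.val_mul]
  · apply mul_inv_mul_inv_eq
    simp only [← ratio_mul q, ← ratio_mul r, ← ratio_mul q', ← ratio_mul r', h.snd, h.trd]
    ext
    push_cast
    linear_combination (ratio q * ratio r : R) * hprod -
      (u * p'.2 * q'.2 * r'.2 * ratio q * ratio r : R) * hsq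
  · grind
  · grind
  · grind

/-- The analogue of `flip_fst` for crossings of opposite sign at the first and third vertex. -/
theorem flip_snd (h : TriangleRatios δ p q r p' q' r' u) :
    TriangleRatios δ p'.swap⁻¹ q r'.swap⁻¹ p.swap⁻¹ q' r.swap⁻¹ u := by
  have h₁ := h.fst_snd
  have h₂ := h.fst_trd
  have htwo := h.two
  have hrel := h.rel
  have hsq := congrArg Units.val h.sq
  have hprod := congrArg Units.val h.prod
  push_cast at hsq hprod
  refine ⟨⟨h.skein.2.2.2.1.swap_inv, h.skein.2.1, h.skein.2.2.2.2.2.swap_inv, h.skein.1.swap_inv,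
    h.skein.2.2.2.2.1, h.skein.2.2.1.swap_inv⟩, h.sq, ?_, ?_, ?_, ?_, h.two, ?_, ?_, ?_⟩ <;>
    simp only [ratio_swap_inv, Prod.snd_inv, Prod.snd_swap, h.fst, h.snd, h.trd, ← mul_assoc,
      h.sq, one_mul, Units.val_mul]
  · rw [mul_comm p'.1⁻¹, mul_right_comm u]
    apply mul_inv_mul_inv_eq
    simp only [← ratio_mul p, ← ratio_mul r, ← ratio_mul p', ← ratio_mul r', h.fst, h.trd]
    ext
    push_cast
    linear_combination (ratio p * ratio r : R) * hprod -
      (u * p'.2 * q'.2 * r'.2 * ratio p * ratio r : R) * hsq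
  · grind
  · grind
  · grind

/-- The analogue of `flip_fst` for crossings of opposite sign at the first and second vertex. -/
theorem flip_trd (h : TriangleRatios δ p q r p' q' r' u) :
    TriangleRatios δ p'.swap⁻¹ q'.swap⁻¹ r p.swap⁻¹ q.swap⁻¹ r' u := by
  have h₁ := h.fst_snd
  have h₂ := h.fst_trd
  have htwo := h.two
  have hrel := h.rel
  have hsq := congrArg Units.val h.sq
  have hprod := congrArg Units.val h.prod
  push_cast at hsq hprod
  refine ⟨⟨h.skein.2.2.2.1.swap_inv, h.skein.2.2.2.2.1.swap_inv, h.skein.2.2.1, h.skein.1.swap_inv,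
    h.skein.2.1.swap_inv, h.skein.2.2.2.2.2⟩, h.sq, ?_, ?_, ?_, ?_, h.two, ?_, ?_, ?_⟩ <;>
    simp only [ratio_swap_inv, Prod.snd_inv, Prod.snd_swap, h.fst, h.snd, h.trd, ← mul_assoc,
      h.sq, one_mul, Units.val_mul]
  · rw [mul_comm _ r.2, mul_right_comm _ _ r'.2, mul_right_comm u _ r'.2, ← mul_assoc]
    apply mul_inv_mul_inv_eq
    simp only [← ratio_mul p, ← ratio_mul q, ← ratio_mul p', ← ratio_mul q', h.fst, h.snd]
    ext
    push_cast
    linear_combination (ratio p * ratio q : R) * hprod -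
      (u * p'.2 * q'.2 * r'.2 * ratio p * ratio q : R) * hsq
  · grind
  · grind
  · grind

end TriangleRatios

end Triangle

/-! ### Colored crossings and colored triangles -/

section Corner

variable {X : Type u} [Biquandle X]

/-- The colors `u₀`, `u₁` of the ends of the over strand and `v₀`, `v₁` of the ends of the under
strand of a crossing satisfy the crossing relations. The signs `T` and `M` tell whether `v₀` and
`u₁` lie on the right of the crossing. If the over strand is directed from `u₀` to `u₁` or back
according to a sign `ε` and the under strand according to `η`, then `T` and `M` are the products
of the sign of the crossing with `η` and `ε`. -/
def CornerRel (T M : ℤˣ) (u₀ u₁ v₀ v₁ : X) : Prop :=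
  (if T = 1 then v₁ else v₀) = (if T = 1 then v₀ else v₁) ▷ᵤ (if M = 1 then u₁ else u₀) ∧
  (if M = 1 then u₀ else u₁) = (if M = 1 then u₁ else u₀) ▷ₒ (if T = 1 then v₀ else v₁)

theorem neg_one_ne_one_units : (-1 : ℤˣ) ≠ 1 := by decide

theorem CornerRel.symm {T M : ℤˣ} {u₀ u₁ v₀ v₁ : X} (h : CornerRel T M u₀ u₁ v₀ v₁) :
    CornerRel (-T) (-M) u₁ u₀ v₁ v₀ := by
  rcases Int.units_eq_one_or T with rfl | rfl <;> rcases Int.units_eq_one_or M with rfl | rfl <;>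
    simpa [CornerRel, neg_one_ne_one_units] using h

/-- The colors of the two ends at one corner of a crossing determine the other two. -/
theorem CornerRel.unique {T M : ℤˣ} {u₀ u₁ u₁' v₀ v₁ v₁' : X} (h : CornerRel T M u₀ u₁ v₀ v₁)
    (h' : CornerRel T M u₀ u₁' v₀ v₁') : u₁ = u₁' ∧ v₁ = v₁' := by
  rcases Int.units_eq_one_or T with rfl | rfl <;> rcases Int.units_eq_one_or M with rfl | rfl <;>
    simp only [CornerRel, neg_one_ne_one_units, if_true, if_false] at h h'
  · have := (Biquandle.over_bijective v₀).1 (h.2.symm.trans h'.2)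
    exact ⟨this, by rw [h.1, h'.1, this]⟩
  · exact ⟨h.2.trans h'.2.symm, h.1.trans h'.1.symm⟩
  · have := Biquandle.side_bijective.1 (a₁ := (v₁, u₁)) (a₂ := (v₁', u₁'))
      (Prod.ext (h.2.symm.trans h'.2) (h.1.symm.trans h'.1))
    exact ⟨congrArg Prod.snd this, congrArg Prod.fst this⟩
  · have := (Biquandle.under_bijective u₀).1 (h.1.symm.trans h'.1)
    exact ⟨by rw [h.2, h'.2, this], this⟩

theorem CornerRel.exists (T M : ℤˣ) (u₀ v₀ : X) : ∃ u₁ v₁, CornerRel T M u₀ u₁ v₀ v₁ := by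
  rcases Int.units_eq_one_or T with rfl | rfl <;> rcases Int.units_eq_one_or M with rfl | rfl <;>
    simp only [CornerRel, neg_one_ne_one_units, if_true, if_false]
  · obtain ⟨u₁, hu⟩ := (Biquandle.over_bijective v₀).2 u₀
    exact ⟨u₁, _, rfl, hu.symm⟩
  · exact ⟨_, _, rfl, rfl⟩
  · obtain ⟨⟨v₁, u₁⟩, h⟩ := (Biquandle.side_bijective (X := X)).2 (u₀, v₀)
    exact ⟨u₁, v₁, (congrArg Prod.snd h).symm, (congrArg Prod.fst h).symm⟩
  · obtain ⟨v₁, hv⟩ := (Biquandle.under_bijective u₀).2 v₀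
    exact ⟨_, v₁, hv.symm, rfl⟩

theorem CornerRel.unique_left {T M : ℤˣ} {u₀ u₀' u₁ v₀ v₀' v₁ : X}
    (h : CornerRel T M u₀ u₁ v₀ v₁) (h' : CornerRel T M u₀' u₁ v₀' v₁) : u₀ = u₀' ∧ v₀ = v₀' :=
  h.symm.unique h'.symm

variable {R : Type v} [CommRing R] (β : BiquandleBracket X R)

/-- The pair of skein coefficients for the colors `x`, `y`. -/
def BiquandleBracket.pair (x y : X) : Rˣ × Rˣ := (β.A x y, β.B x y)

theorem BiquandleBracket.isSkein (x y : X) : IsSkein β.δ (β.pair x y) := by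
  have h := β.δ_eq x y
  unfold IsSkein ratio BiquandleBracket.pair
  rw [mul_inv, inv_inv]
  linear_combination -h

/-- The bracket equations, for strands with the colors `x`, `y`, `z` from bottom to top. -/
theorem BiquandleBracket.exists_ratios (x y z : X) : ∃ u, TriangleRatios β.δ
    (β.pair y z) (β.pair (x ▷ᵤ y) (z ▷ₒ y)) (β.pair x y)
    (β.pair (y ▷ₒ x) (z ▷ₒ x)) (β.pair x z) (β.pair (x ▷ᵤ z) (y ▷ᵤ z)) u := by
  apply TriangleRel.exists_ratios <;> try apply β.isSkein
  have h₁ := β.AAA x y z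
  have h₂ := β.BAB x y z
  have h₃ := β.ABB x y z
  have h₄ := β.BAA x y z
  have h₅ := β.AAB x y z
  simp only [TriangleRel, BiquandleBracket.pair]
  refine ⟨?_, ?_, ?_, ?_, ?_⟩
  · linear_combination h₁
  · linear_combination h₂
  · linear_combination h₃
  · linear_combination h₄
  · linear_combination h₅

/-- The coefficients of the two resolutions of a crossing in a triangle whose vertices are in
counterclockwise order; for the clockwise order they have to be inverted. The crossing has the
sign `T * M`. -/
def BiquandleBracket.cornerPair (T M : ℤˣ) (u₀ u₁ v₀ v₁ : X) : Rˣ × Rˣ :=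
  let P := β.pair (if T = 1 then v₀ else v₁) (if M = 1 then u₁ else u₀)
  if T * M = 1 then P else P.swap⁻¹

/-- A coloring of the strands on one side of a third Reidemeister move can be carried over to the
other side, and the coefficients on both sides satisfy the bracket equations. In each of the eight
cases there are `x`, `y`, `z` such that every crossing has, up to orientation, the colors of one
of the six crossings in the defining equations of a bracket. -/
theorem BiquandleBracket.exists_triangle {T M B : ℤˣ} {u₀ u₁ u₂ v₀ v₁ v₂ w₀ w₁ w₂ : X}
    (hp : CornerRel T M u₀ u₁ v₀ v₁) (hq : CornerRel T B u₁ u₂ w₀ w₁)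
    (hr : CornerRel M B v₁ v₂ w₁ w₂) :
    ∃ u₁' v₁' w₁', CornerRel T M u₁' u₂ v₁' v₂ ∧ CornerRel T B u₀ u₁' w₁' w₂ ∧
      CornerRel M B v₀ v₁' w₀ w₁' ∧
      ∃ u, TriangleRatios β.δ (β.cornerPair T M u₀ u₁ v₀ v₁) (β.cornerPair T B u₁ u₂ w₀ w₁)
        (β.cornerPair M B v₁ v₂ w₁ w₂) (β.cornerPair T M u₁' u₂ v₁' v₂)
        (β.cornerPair T B u₀ u₁' w₁' w₂) (β.cornerPair M B v₀ v₁' w₀ w₁') u := by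
  have e₁ : ∀ x y z : X, (x ▷ᵤ z) ▷ᵤ (y ▷ᵤ z) = (x ▷ᵤ y) ▷ᵤ (z ▷ₒ y) := fun x y z =>
    Biquandle.exchange_under_under x z y
  have e₂ : ∀ x y z : X, (y ▷ᵤ z) ▷ₒ (x ▷ᵤ z) = (y ▷ₒ x) ▷ᵤ (z ▷ₒ x) := fun x y z =>
    Biquandle.exchange_under_over y z x
  have e₃ : ∀ x y z : X, (z ▷ₒ x) ▷ₒ (y ▷ₒ x) = (z ▷ₒ y) ▷ₒ (x ▷ᵤ y) := fun x y z =>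
    Biquandle.exchange_over_over z x y
  rcases Int.units_eq_one_or T with rfl | rfl <;> rcases Int.units_eq_one_or M with rfl | rfl <;>
    rcases Int.units_eq_one_or B with rfl | rfl <;>
    simp only [CornerRel, BiquandleBracket.cornerPair, neg_one_ne_one_units, if_true, if_false,
      mul_one, mul_neg, neg_neg] at hp hq hr ⊢ <;>
    obtain ⟨hp₁, hp₂⟩ := hp <;> obtain ⟨hq₁, hq₂⟩ := hq <;> obtain ⟨hr₁, hr₂⟩ := hr
  · obtain ⟨y, rfl⟩ := (Biquandle.over_bijective w₀).2 v₀
    subst hq₁ hq₂ hp₁ hp₂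
    have h := hr₂
    rw [← e₂] at h
    obtain rfl := (Biquandle.over_bijective _).1 h
    subst hr₁
    obtain ⟨u, h⟩ := β.exists_ratios w₀ y u₂
    exact ⟨_, _, _, ⟨rfl, rfl⟩, ⟨e₁ _ _ _, e₃ _ _ _⟩, ⟨rfl, rfl⟩, u, h.symm⟩
  · subst hp₁ hp₂ hq₁ hq₂ hr₁ hr₂
    obtain ⟨u, h⟩ := β.exists_ratios w₀ v₀ u₁
    exact ⟨_, _, _, ⟨e₂ _ _ _, rfl⟩, ⟨e₁ _ _ _, e₃ _ _ _⟩, ⟨rfl, rfl⟩, u, h.flip_fst⟩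
  · obtain ⟨⟨x, y⟩, hxy⟩ := (Biquandle.side_bijective (X := X)).2 (v₀, w₀)
    obtain ⟨rfl, rfl⟩ := Prod.ext_iff.1 hxy
    obtain ⟨z, rfl⟩ := (Biquandle.over_bijective x).2 u₀
    have h := hp₂.symm.trans hq₂
    dsimp only at h hp₁ hp₂ hq₁ hq₂ hr₁ hr₂
    rw [e₃] at h
    obtain rfl := (Biquandle.over_bijective _).1 h
    have h := Biquandle.side_bijective.1 (a₁ := (x ▷ᵤ z, y ▷ᵤ z)) (a₂ := (w₂, v₂))
      (Prod.ext ((e₂ x y z).trans (hp₁.symm.trans hr₂))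
        ((e₁ x y z).trans (hq₁.symm.trans hr₁)))
    obtain ⟨rfl, rfl⟩ := Prod.ext_iff.1 h
    obtain ⟨u, h⟩ := β.exists_ratios x y z
    exact ⟨_, _, _, ⟨rfl, rfl⟩, ⟨rfl, rfl⟩, ⟨rfl, rfl⟩, u, h.flip_snd⟩
  · obtain ⟨x, rfl⟩ := (Biquandle.under_bijective v₀).2 w₀
    subst hp₁ hp₂
    have h := hq₁.symm.trans hr₁
    dsimp only at h hq₁ hq₂
    rw [← e₁] at h
    obtain rfl := (Biquandle.under_bijective _).1 h
    subst hq₁ hq₂ hr₂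
    obtain ⟨u, h⟩ := β.exists_ratios x v₀ u₀
    exact ⟨_, _, _, ⟨e₂ _ _ _, (e₃ _ _ _).symm⟩, ⟨rfl, rfl⟩, ⟨rfl, rfl⟩, u, h.flip_trd.symm⟩
  · subst hr₁ hr₂ hq₁ hq₂ hp₁ hp₂
    obtain ⟨u, h⟩ := β.exists_ratios w₁ v₂ u₂
    exact ⟨_, _, _, ⟨rfl, rfl⟩, ⟨rfl, e₃ _ _ _⟩, ⟨(e₁ _ _ _).symm, (e₂ _ _ _).symm⟩, u,
      h.flip_trd⟩
  · subst hp₁ hp₂ hq₁ hq₂ hr₁ hr₂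
    obtain ⟨u, h⟩ := β.exists_ratios w₁ v₁ u₁
    exact ⟨_, _, _, ⟨rfl, rfl⟩, ⟨e₁ _ _ _, e₃ _ _ _⟩, ⟨rfl, (e₂ _ _ _).symm⟩, u,
      h.flip_snd.symm⟩
  · obtain ⟨z, rfl⟩ := (Biquandle.over_bijective v₂).2 u₂
    subst hr₁ hr₂
    have h := hp₂.symm.trans hq₂
    dsimp only at h hq₁ hq₂
    rw [← e₃] at h
    obtain rfl := (Biquandle.over_bijective _).1 h
    subst hp₁ hp₂ hq₁
    obtain ⟨u, h⟩ := β.exists_ratios w₂ v₂ z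
    exact ⟨_, _, _, ⟨rfl, rfl⟩, ⟨rfl, rfl⟩, ⟨(e₁ _ _ _).symm, (e₂ _ _ _).symm⟩, u,
      h.flip_fst.symm⟩
  · subst hp₁ hp₂ hr₁ hr₂ hq₁ hq₂
    obtain ⟨u, h⟩ := β.exists_ratios w₂ v₁ u₀
    exact ⟨_, _, _, ⟨rfl, (e₃ _ _ _).symm⟩, ⟨rfl, rfl⟩, ⟨(e₁ _ _ _).symm, (e₂ _ _ _).symm⟩, u, h⟩

end Corner

/-! ### State sums of diagrams -/

/-- Two lists of pairs are identified by the same functions. -/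
def SamePairs {S : Type} (l l' : List (S × S)) : Prop :=
  ∀ {α : Type} (q : S → α), (∀ p ∈ l, q p.1 = q p.2) ↔ ∀ p ∈ l', q p.1 = q p.2

theorem SamePairs.append {S : Type} {l₁ l₁' l₂ l₂' : List (S × S)} (h₁ : SamePairs l₁ l₁')
    (h₂ : SamePairs l₂ l₂') : SamePairs (l₁ ++ l₂) (l₁' ++ l₂') := by
  intro α q
  simp only [List.forall_mem_append, h₁ q, h₂ q]

/-- Two resolutions that agree up to the order of their pairs and of the two summands. -/
def Resolution.Equivalent {R : Type v} {S : Type} (r r' : Resolution R S) : Prop :=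
  (r.fstCoeff = r'.fstCoeff ∧ r.sndCoeff = r'.sndCoeff ∧
    SamePairs r.fstPairs r'.fstPairs ∧ SamePairs r.sndPairs r'.sndPairs) ∨
  (r.fstCoeff = r'.sndCoeff ∧ r.sndCoeff = r'.fstCoeff ∧
    SamePairs r.fstPairs r'.sndPairs ∧ SamePairs r.sndPairs r'.fstPairs)

theorem stateSum_congr {R : Type v} [CommRing R] {S : Type} {δ : R} {E : S → S → Prop}
    {rs rs' : List (Resolution R S)} (h : List.Forall₂ Resolution.Equivalent rs rs') :
    ∀ {l l' : List (S × S)}, SamePairs l l' → stateSum δ E rs l = stateSum δ E rs' l' := by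
  induction h with
  | nil => exact fun hl => congrArg (δ ^ ·) (numClasses_congr hl)
  | cons hr _ ih =>
    intro l l' hl
    rcases hr with ⟨h₁, h₂, h₃, h₄⟩ | ⟨h₁, h₂, h₃, h₄⟩
    · simp only [stateSum, h₁, h₂, ih (h₃.append hl), ih (h₄.append hl)]
    · simp only [stateSum, h₁, h₂, ih (h₃.append hl), ih (h₄.append hl)]
      rw [add_comm]

theorem crossingResolution_reverse {R : Type v} {S : Type} (a b : R) (u₀ u₁ v₀ v₁ : S) :
    (crossingResolution a b u₀ u₁ v₀ v₁).Equivalent (crossingResolution a b u₁ u₀ v₁ v₀) := by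
  refine Or.inl ⟨rfl, rfl, ?_, ?_⟩ <;> intro α q <;> simp [crossingResolution, and_comm]

/-- The third Reidemeister move for state sums. -/
theorem TriangleRel.stateSum_eq {R : Type v} [CommRing R] {S : Type} {δ : R} {E : S → S → Prop}
    [Finite S] {p q r p' q' r' : Rˣ × Rˣ} (h : TriangleRel δ p q r p' q' r')
    {u₀ u₁ u₂ v₀ v₁ v₂ w₀ w₁ w₂ : S}
    (hu : IsIsolated E u₁) (hv : IsIsolated E v₁) (hw : IsIsolated E w₁)
    (huv : u₁ ≠ v₁) (huw : u₁ ≠ w₁) (hvw : v₁ ≠ w₁)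
    (hu₀ : u₀ ≠ u₁ ∧ u₀ ≠ v₁ ∧ u₀ ≠ w₁) (hu₂ : u₂ ≠ u₁ ∧ u₂ ≠ v₁ ∧ u₂ ≠ w₁)
    (hv₀ : v₀ ≠ u₁ ∧ v₀ ≠ v₁ ∧ v₀ ≠ w₁) (hv₂ : v₂ ≠ u₁ ∧ v₂ ≠ v₁ ∧ v₂ ≠ w₁)
    (hw₀ : w₀ ≠ u₁ ∧ w₀ ≠ v₁ ∧ w₀ ≠ w₁) (hw₂ : w₂ ≠ u₁ ∧ w₂ ≠ v₁ ∧ w₂ ≠ w₁) :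
    stateSum δ E [crossingResolution (p.1 : R) p.2 u₀ u₁ v₀ v₁,
      crossingResolution (q.1 : R) q.2 u₁ u₂ w₀ w₁,
      crossingResolution (r.1 : R) r.2 v₁ v₂ w₁ w₂] [] =
    stateSum δ E [crossingResolution (p'.1 : R) p'.2 u₁ u₂ v₁ v₂,
      crossingResolution (q'.1 : R) q'.2 u₀ u₁ w₁ w₂,
      crossingResolution (r'.1 : R) r'.2 v₀ v₁ w₀ w₁] [] := by
  rw [stateSum_congr (rs' := [crossingResolution (p'.1 : R) p'.2 u₂ u₁ v₂ v₁,
      crossingResolution (q'.1 : R) q'.2 u₁ u₀ w₂ w₁,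
      crossingResolution (r'.1 : R) r'.2 v₁ v₀ w₁ w₀])
      (.cons (crossingResolution_reverse _ _ _ _ _ _)
      (.cons (crossingResolution_reverse _ _ _ _ _ _)
      (.cons (crossingResolution_reverse _ _ _ _ _ _) .nil))) (l' := []) (fun _ => Iff.rfl),
    stateSum_triangle _ _ _ _ _ _ hu hv hw huv huw hvw hu₀ hu₂ hv₀ hv₂ hw₀ hw₂,
    stateSum_triangle _ _ _ _ _ _ hu hv hw huv huw hvw hu₂ hu₀ hv₂ hv₀ hw₂ hw₀]
  obtain ⟨h₁, h₂, h₃, h₄, h₅⟩ := h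
  have c₁ : numClasses E [(u₂, w₀), (v₂, v₀), (u₀, w₂)] =
      numClasses E [(u₀, w₂), (v₀, v₂), (u₂, w₀)] :=
    numClasses_congr fun q => by simp; grind
  have c₂ : numClasses E [(u₂, v₂), (u₀, w₂), (v₀, w₀)] =
      numClasses E [(u₀, w₂), (v₀, w₀), (u₂, v₂)] :=
    numClasses_congr fun q => by simp; grind
  have c₃ : numClasses E [(u₂, w₀), (v₂, w₂), (u₀, v₀)] =
      numClasses E [(u₀, v₀), (u₂, w₀), (v₂, w₂)] :=
    numClasses_congr fun q => by simp; grind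
  have c₄ : numClasses E [(u₂, u₀), (v₂, w₂), (v₀, w₀)] =
      numClasses E [(u₀, u₂), (v₀, w₀), (v₂, w₂)] :=
    numClasses_congr fun q => by simp; grind
  have c₅ : numClasses E [(u₂, v₂), (w₂, w₀), (u₀, v₀)] =
      numClasses E [(u₀, v₀), (w₀, w₂), (u₂, v₂)] :=
    numClasses_congr fun q => by simp; grind
  rw [c₁, c₂, c₃, c₄, c₅, h₁, h₂, h₃, h₄, h₅]
  ring

namespace LinkDiagram

/-- The end of a strand at a crossing: the incoming one for `ε = 1`, the outgoing one for
`ε = -1`. -/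
def strandEnd (D : LinkDiagram) (ε : ℤˣ) (a : D.Crossing × Strand) : D.Semiarc :=
  if ε = 1 then D.inn a else D.out a

@[simp] theorem strandEnd_one (D : LinkDiagram) (a) : D.strandEnd 1 a = D.inn a := if_pos rfl

@[simp] theorem strandEnd_neg_one (D : LinkDiagram) (a) : D.strandEnd (-1) a = D.out a :=
  if_neg (by decide)

theorem strandEnd_injective (D : LinkDiagram) (ε : ℤˣ) : Function.Injective (D.strandEnd ε) := by
  rcases Int.units_eq_one_or ε with rfl | rfl
  · exact fun a b h => D.inn_injective (by simpa using h)
  · exact fun a b h => D.out_injective (by simpa using h)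

theorem Consecutive.strandEnd_eq {D : LinkDiagram} {ε : ℤˣ} {a b : D.Crossing × Strand}
    (h : D.Consecutive ε a b) : D.strandEnd (-ε) a = D.strandEnd ε b := by
  rcases h with ⟨rfl, h⟩ | ⟨rfl, h⟩ <;> simp [h]

/-- A semiarc that joins `a` to `b` touches no other strand. -/
theorem strandEnd_eq_cases {D : LinkDiagram} {ε η : ℤˣ} {a b c : D.Crossing × Strand}
    (h : D.strandEnd ε a = D.strandEnd (-ε) b) (h' : D.strandEnd η c = D.strandEnd ε a) :
    (η = ε ∧ c = a) ∨ (η = -ε ∧ c = b) := by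
  rcases Int.units_eq_one_or ε with rfl | rfl <;> rcases Int.units_eq_one_or η with rfl | rfl
  · exact Or.inl ⟨rfl, D.strandEnd_injective _ h'⟩
  · exact Or.inr ⟨rfl, D.strandEnd_injective _ (h'.trans h)⟩
  · exact Or.inr ⟨by simp, D.strandEnd_injective _ (h'.trans h)⟩
  · exact Or.inl ⟨rfl, D.strandEnd_injective _ h'⟩

/-- The pairs of semiarcs that a smoothing joins. -/
def smoothPairs (D : LinkDiagram) (c : D.Crossing) : Smoothing → List (D.Semiarc × D.Semiarc)
  | .oriented => [(D.inn (c, .upper), D.out (c, .lower)), (D.inn (c, .lower), D.out (c, .upper))]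
  | .disoriented => [(D.inn (c, .upper), D.inn (c, .lower)),
      (D.out (c, .upper), D.out (c, .lower))]

theorem joined_iff (D : LinkDiagram) (σ : D.Crossing → Smoothing) (a b : D.Semiarc) :
    D.Joined σ a b ↔ ∃ c, (a, b) ∈ D.smoothPairs c (σ c) := by
  constructor
  · rintro (⟨c, h⟩ | ⟨c, h⟩ | ⟨c, h⟩ | ⟨c, h⟩) <;> exact ⟨c, by simp [smoothPairs, h]⟩
  · rintro ⟨c, h⟩
    cases hc : σ c <;> simp only [smoothPairs, hc, List.mem_cons, Prod.mk.injEq,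
      List.not_mem_nil, or_false] at h <;> rcases h with ⟨rfl, rfl⟩ | ⟨rfl, rfl⟩
    · exact .overUnder c hc
    · exact .underOver c hc
    · exact .incoming c hc
    · exact .outgoing c hc

/-- The relation between semiarcs that is generated by the smoothings of the crossings `e k`. -/
def outerJoined (D : LinkDiagram) {κ : Type} (e : κ → D.Crossing) (σ : κ → Smoothing)
    (a b : D.Semiarc) : Prop :=
  ∃ k, (a, b) ∈ D.smoothPairs (e k) (σ k)

section Bracket

variable {X : Type u} {R : Type v} [Biquandle X] [CommRing R]

/-- The two smoothings of a crossing of a colored diagram. -/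
noncomputable def resolution (D : LinkDiagram) (β : BiquandleBracket X R) (f : D.Semiarc → X)
    (c : D.Crossing) : Resolution R D.Semiarc :=
  ⟨(D.coeff β f c .oriented : Rˣ), (D.coeff β f c .disoriented : Rˣ), D.smoothPairs c .oriented,
    D.smoothPairs c .disoriented⟩

/-- The recursive state sum as a sum over all choices of smoothings. -/
theorem stateSum_ofFn (D : LinkDiagram) (β : BiquandleBracket X R) (f : D.Semiarc → X)
    (E : D.Semiarc → D.Semiarc → Prop) : ∀ {n : ℕ} (e : Fin n → D.Crossing) (l),
    stateSum β.δ E (List.ofFn fun i => D.resolution β f (e i)) l =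
      ∑ τ : Fin n → Smoothing, ((∏ i, D.coeff β f (e i) (τ i) : Rˣ) : R) *
        β.δ ^ numClasses (fun a b => E a b ∨ D.outerJoined e τ a b) l
  | 0, e, l => by
    simp [stateSum, outerJoined]
  | n + 1, e, l => by
    have hE : ∀ (s : Smoothing) (τ : Fin n → Smoothing),
        numClasses (fun a b => E a b ∨ D.outerJoined (fun i => e i.succ) τ a b)
          (D.smoothPairs (e 0) s ++ l) =
        numClasses (fun a b => E a b ∨ D.outerJoined e (Fin.cons s τ) a b) l := by
      intro s τ
      unfold numClasses
      have : (fun a b => (E a b ∨ D.outerJoined (fun i => e i.succ) τ a b) ∨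
          (a, b) ∈ D.smoothPairs (e 0) s ++ l) =
        (fun a b => (E a b ∨ D.outerJoined e (Fin.cons s τ) a b) ∨ (a, b) ∈ l) := by
        funext a b
        simp only [outerJoined, Fin.exists_fin_succ, Fin.cons_zero, Fin.cons_succ,
          List.mem_append, eq_iff_iff]
        tauto
      rw [this]
    rw [List.ofFn_succ, stateSum, ← (Fin.consEquiv fun _ => Smoothing).sum_comp,
      Fintype.sum_prod_type]
    have hsum : ∀ F : Smoothing → R, ∑ s, F s = F .oriented + F .disoriented := by
      intro F
      exact Finset.sum_pair (by decide)
    rw [hsum]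
    simp only [stateSum_ofFn D β f E (fun i => e i.succ)]
    simp [resolution, Finset.mul_sum, hE, Fin.consEquiv, Fin.prod_univ_succ, mul_assoc]

open Classical in
/-- The sum over the smoothings of finitely many crossings `e (inl i)` is taken first. -/
theorem bracketValue_eq_sum (D : LinkDiagram) (β : BiquandleBracket X R) (f : D.Semiarc → X)
    {n : ℕ} {κ : Type} [Fintype κ] (e : Fin n ⊕ κ ≃ D.Crossing) :
    D.bracketValue β f = ((β.w ^ (-D.writhe) : Rˣ) : R) *
      ∑ σ : κ → Smoothing, ((∏ k, D.coeff β f (e (.inr k)) (σ k) : Rˣ) : R) *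
        stateSum β.δ (D.outerJoined (fun k => e (.inr k)) σ)
          (List.ofFn fun i => D.resolution β f (e (.inl i))) [] := by
  have hloops : ∀ (τ : Fin n → Smoothing) (σ : κ → Smoothing),
      D.loops (fun c => Sum.elim τ σ (e.symm c)) =
      numClasses (fun a b => D.outerJoined (fun k => e (.inr k)) σ a b ∨
        D.outerJoined (fun i => e (.inl i)) τ a b) [] := by
    intro τ σ
    have h : D.Joined (fun c => Sum.elim τ σ (e.symm c)) = fun a b =>
        (D.outerJoined (fun k => e (.inr k)) σ a b ∨
          D.outerJoined (fun i => e (.inl i)) τ a b) ∨ (a, b) ∈ [] := by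
      funext a b
      rw [eq_iff_iff, joined_iff, e.symm.exists_congr_left]
      simp [outerJoined, or_comm]
    unfold loops numClasses
    rw [h]
  unfold bracketValue
  congr 1
  rw [← ((Equiv.sumArrowEquivProdArrow _ _ _).symm.trans
    (e.arrowCongr (Equiv.refl Smoothing))).sum_comp, Fintype.sum_prod_type_right]
  refine Finset.sum_congr rfl fun σ _ => ?_
  rw [stateSum_ofFn, Finset.mul_sum]
  refine Finset.sum_congr rfl fun τ _ => ?_
  rw [← e.prod_comp, Fintype.prod_sum_type, ← mul_assoc, ← Units.val_mul, mul_comm (∏ k, _),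
    ← hloops]
  congr 2
  simp

/-- The coefficients of the two resolutions of a crossing whose over strand is directed by `ε` and
whose under strand is directed by `η`, see `resolution_equivalent`. -/
noncomputable def crossingPair (D : LinkDiagram) (β : BiquandleBracket X R) (f : D.Semiarc → X)
    (c : D.Crossing) (ε η : ℤˣ) : Rˣ × Rˣ :=
  let P := β.pair (f (D.rightUnder c)) (f (D.rightOver c)) ^ (D.sign c : ℤ)
  if ε * η = 1 then P else P.swap

theorem resolution_equivalent (D : LinkDiagram) (β : BiquandleBracket X R) (f : D.Semiarc → X)
    (c : D.Crossing) (ε η : ℤˣ) : (D.resolution β f c).Equivalent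
      (crossingResolution ((D.crossingPair β f c ε η).1 : R) (D.crossingPair β f c ε η).2
        (D.strandEnd ε (c, .upper)) (D.strandEnd (-ε) (c, .upper))
        (D.strandEnd η (c, .lower)) (D.strandEnd (-η) (c, .lower))) := by
  rcases Int.units_eq_one_or ε with rfl | rfl <;> rcases Int.units_eq_one_or η with rfl | rfl
  · refine Or.inl ⟨rfl, rfl, ?_, ?_⟩ <;> intro α q <;>
      simp [resolution, crossingResolution, smoothPairs, eq_comm]
  · refine Or.inr ⟨rfl, rfl, ?_, ?_⟩ <;> intro α q <;>
      simp [resolution, crossingResolution, smoothPairs, eq_comm]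
  · refine Or.inr ⟨rfl, rfl, ?_, ?_⟩ <;> intro α q <;>
      simp [resolution, crossingResolution, smoothPairs, eq_comm, and_comm]
  · refine Or.inl ⟨rfl, rfl, ?_, ?_⟩ <;> intro α q <;>
      simp [resolution, crossingResolution, smoothPairs, eq_comm, and_comm]

/-- The coloring condition at a single crossing. -/
def IsColoringAt (D : LinkDiagram) (f : D.Semiarc → X) (c : D.Crossing) : Prop :=
  f (D.leftUnder c) = f (D.rightUnder c) ▷ᵤ f (D.rightOver c) ∧
    f (D.leftOver c) = f (D.rightOver c) ▷ₒ f (D.rightUnder c)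

theorem isColoringAt_iff (D : LinkDiagram) (f : D.Semiarc → X) (c : D.Crossing) (ε η : ℤˣ) :
    D.IsColoringAt f c ↔ CornerRel (D.sign c * η) (D.sign c * ε)
      (f (D.strandEnd ε (c, .upper))) (f (D.strandEnd (-ε) (c, .upper)))
      (f (D.strandEnd η (c, .lower))) (f (D.strandEnd (-η) (c, .lower))) := by
  unfold IsColoringAt CornerRel leftUnder rightUnder leftOver rightOver
  rcases Int.units_eq_one_or ε with rfl | rfl <;> rcases Int.units_eq_one_or η with rfl | rfl <;>
    rcases Int.units_eq_one_or (D.sign c) with h | h <;>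
    simp [h]

theorem crossingPair_eq (D : LinkDiagram) (β : BiquandleBracket X R) (f : D.Semiarc → X)
    (c : D.Crossing) (ε η : ℤˣ) : D.crossingPair β f c ε η =
      β.cornerPair (D.sign c * η) (D.sign c * ε)
      (f (D.strandEnd ε (c, .upper))) (f (D.strandEnd (-ε) (c, .upper)))
      (f (D.strandEnd η (c, .lower))) (f (D.strandEnd (-η) (c, .lower))) ^
        ((D.sign c * ε * η : ℤˣ) : ℤ) := by
  unfold crossingPair BiquandleBracket.cornerPair rightUnder rightOver
  rcases Int.units_eq_one_or ε with rfl | rfl <;> rcases Int.units_eq_one_or η with rfl | rfl <;>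
    rcases Int.units_eq_one_or (D.sign c) with h | h <;>
    simp [h]

end Bracket

end LinkDiagram

/-! ### Comparison of the colorings of two diagrams -/

namespace LinkDiagram

section Transfer

variable {X : Type u} {R : Type v} [Biquandle X] [CommRing R]

/-- The homsets of two diagrams are in bijection, and the bijection preserves the bracket values
and commutes with the endomorphisms of `X`. -/
def SameBracketHomset (β : BiquandleBracket X R) (D D' : LinkDiagram) : Prop :=
  ∃ Φ : D.Homset X ≃ D'.Homset X,
    (∀ f, D'.bracketValue β (Φ f).color = D.bracketValue β f.color) ∧
    ∀ (φ : BiquandleHom X X) f, Φ (φ.comp f) = φ.comp (Φ f)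

/-- A bijection between the homsets is given by a correspondence of colorings that are determined
by their values on corresponding semiarcs `a ∈ O` and `π a`. Endomorphisms act on the values, so
that they respect the correspondence. -/
theorem SameBracketHomset.of_agree {β : BiquandleBracket X R} {D D' : LinkDiagram}
    (O : Set D.Semiarc) (π : D.Semiarc → D'.Semiarc)
    (h : ∀ f : D.Semiarc → X, D.IsColoring f →
      ∃ f' : D'.Semiarc → X, D'.IsColoring f' ∧ ∀ a ∈ O, f' (π a) = f a)
    (h' : ∀ f' : D'.Semiarc → X, D'.IsColoring f' →
      ∃ f : D.Semiarc → X, D.IsColoring f ∧ ∀ a ∈ O, f' (π a) = f a)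
    (hu : ∀ f g : D.Semiarc → X, D.IsColoring f → D.IsColoring g → (∀ a ∈ O, f a = g a) → f = g)
    (hu' : ∀ f g : D'.Semiarc → X, D'.IsColoring f → D'.IsColoring g →
      (∀ a ∈ O, f (π a) = g (π a)) → f = g)
    (hβ : ∀ (f : D.Semiarc → X) (f' : D'.Semiarc → X), D.IsColoring f → D'.IsColoring f' →
      (∀ a ∈ O, f' (π a) = f a) → D'.bracketValue β f' = D.bracketValue β f) :
    SameBracketHomset β D D' := by
  have hΦ : ∀ f : D.Homset X, ∃ f' : D'.Homset X, ∀ a ∈ O, f'.color (π a) = f.color a := by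
    intro f
    obtain ⟨f', hf', ha⟩ := h f.color f.isColoring
    obtain ⟨g, rfl⟩ := hf'.exists_color_eq
    exact ⟨g, ha⟩
  have hΨ : ∀ f' : D'.Homset X, ∃ f : D.Homset X, ∀ a ∈ O, f'.color (π a) = f.color a := by
    intro f'
    obtain ⟨f, hf, ha⟩ := h' f'.color f'.isColoring
    obtain ⟨g, rfl⟩ := hf.exists_color_eq
    exact ⟨g, ha⟩
  have uniq : ∀ f g : D.Homset X, (∀ a ∈ O, f.color a = g.color a) → f = g := fun f g hfg =>
    Homset.color_injective (hu _ _ f.isColoring g.isColoring hfg)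
  have uniq' : ∀ f g : D'.Homset X, (∀ a ∈ O, f.color (π a) = g.color (π a)) → f = g :=
    fun f g hfg => Homset.color_injective (hu' _ _ f.isColoring g.isColoring hfg)
  choose Φ hΦ using hΦ
  choose Ψ hΨ using hΨ
  refine ⟨⟨Φ, Ψ, fun f => uniq _ _ fun a ha => ?_, fun f => uniq' _ _ fun a ha => ?_⟩,
    fun f => hβ _ _ f.isColoring (Φ f).isColoring (hΦ f),
    fun φ f => uniq' _ _ fun a ha => ?_⟩
  · rw [← hΨ _ a ha, hΦ f a ha]
  · rw [hΦ _ a ha, hΨ f a ha]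
  · exact (hΦ (φ.comp f) a ha).trans (congrArg φ.toFun (hΦ f a ha).symm)

/-- At crossings of the same sign with equally colored ends the coloring conditions and the skein
coefficients agree. -/
theorem crossing_congr {D D' : LinkDiagram} {f : D.Semiarc → X} {f' : D'.Semiarc → X}
    {c : D.Crossing} {c' : D'.Crossing} (hsign : D'.sign c' = D.sign c)
    (hinn : ∀ s, f' (D'.inn (c', s)) = f (D.inn (c, s)))
    (hout : ∀ s, f' (D'.out (c', s)) = f (D.out (c, s))) :
    (D'.IsColoringAt f' c' ↔ D.IsColoringAt f c) ∧
      ∀ (β : BiquandleBracket X R) s, D'.coeff β f' c' s = D.coeff β f c s := by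
  have h₁ : f' (D'.rightUnder c') = f (D.rightUnder c) := by
    unfold rightUnder
    rw [hsign]
    split_ifs <;> simp [hinn, hout]
  have h₂ : f' (D'.rightOver c') = f (D.rightOver c) := by
    unfold rightOver
    rw [hsign]
    split_ifs <;> simp [hinn, hout]
  have h₃ : f' (D'.leftUnder c') = f (D.leftUnder c) := by
    unfold leftUnder
    rw [hsign]
    split_ifs <;> simp [hinn, hout]
  have h₄ : f' (D'.leftOver c') = f (D.leftOver c) := by
    unfold leftOver
    rw [hsign]
    split_ifs <;> simp [hinn, hout]
  refine ⟨by rw [IsColoringAt, IsColoringAt, h₁, h₂, h₃, h₄], fun β s => ?_⟩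
  cases s <;> simp only [coeff, h₁, h₂, hsign]

/-- A semiarc that meets none of the crossings `e k` is not joined to anything there. -/
theorem isIsolated_outerJoined {D : LinkDiagram} {κ : Type} {e : κ → D.Crossing}
    {σ : κ → Smoothing} {m : D.Semiarc}
    (h : ∀ k s, D.inn (e k, s) ≠ m ∧ D.out (e k, s) ≠ m) :
    IsIsolated (D.outerJoined e σ) m := by
  have key : ∀ a b, D.outerJoined e σ a b → a ≠ m ∧ b ≠ m := by
    rintro a b ⟨k, hk⟩
    cases hσ : σ k <;> simp only [smoothPairs, hσ, List.mem_cons, Prod.mk.injEq,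
      List.not_mem_nil, or_false] at hk <;> rcases hk with ⟨rfl, rfl⟩ | ⟨rfl, rfl⟩ <;>
      simp [h]
  exact fun x => ⟨fun hx => (key _ _ hx).1 rfl, fun hx => (key _ _ hx).2 rfl⟩

/-! ### Moves that remove crossings -/

/-- The pairs of semiarcs that are joined if the two strands are pulled apart at the crossings in
a list. -/
def straightPairs (D : LinkDiagram) (l : List D.Crossing) : List (D.Semiarc × D.Semiarc) :=
  l.flatMap fun c => [(D.inn (c, .upper), D.out (c, .upper)),
    (D.inn (c, .lower), D.out (c, .lower))]

theorem mem_straightPairs {D : LinkDiagram} {l : List D.Crossing} {a b : D.Semiarc} :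
    (a, b) ∈ D.straightPairs l ↔ ∃ c ∈ l, ∃ s, a = D.inn (c, s) ∧ b = D.out (c, s) := by
  simp only [straightPairs, List.mem_flatMap, List.mem_cons, Prod.mk.injEq, List.not_mem_nil,
    or_false]
  refine exists_congr fun c => and_congr_right fun _ => ⟨?_, ?_⟩
  · rintro (h | h)
    exacts [⟨_, h⟩, ⟨_, h⟩]
  · rintro ⟨_ | _, h⟩
    exacts [Or.inr h, Or.inl h]

/-- The closed curves of a state after the crossings in `l` are removed are those of the state
before, with the strands pulled apart at these crossings. -/
theorem loops_eq_of_forgets {D D' : LinkDiagram} {l : List D.Crossing}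
    {e : D'.Crossing → D.Crossing} {π : D.Semiarc → D'.Semiarc} (hπ : Function.Surjective π)
    (hrel : ∀ a b, π a = π b ↔ Relation.EqvGen (fun a b => (a, b) ∈ D.straightPairs l) a b)
    (hinn : ∀ c s, D'.inn (c, s) = π (D.inn (e c, s)))
    (hout : ∀ c s, D'.out (c, s) = π (D.out (e c, s))) (σ : D'.Crossing → Smoothing) :
    D'.loops σ = numClasses (D.outerJoined e σ) (D.straightPairs l) := by
  let r : D.Semiarc → D.Semiarc → Prop :=
    fun a b => D.outerJoined e σ a b ∨ (a, b) ∈ D.straightPairs l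
  have hpairs : ∀ c s, D'.smoothPairs c s = (D.smoothPairs (e c) s).map (Prod.map π π) := by
    intro c s
    cases s <;> simp [smoothPairs, hinn, hout]
  have hmk : ∀ a b, π a = π b → (Quot.mk r a) = Quot.mk r b := by
    intro a b hab
    have := (hrel a b).1 hab
    induction this with
    | rel a b h => exact Quot.sound (Or.inr h)
    | refl a => rfl
    | symm a b _ ih => exact (ih ((hrel _ _).2 ‹_›)).symm
    | trans a b c _ _ ih ih' => exact (ih ((hrel _ _).2 ‹_›)).trans (ih' ((hrel _ _).2 ‹_›))
  have hinv := Function.surjInv_eq hπ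
  refine Nat.card_congr (Equiv.symm
    { toFun := Quot.lift (fun a => Quot.mk (D'.Joined σ) (π a)) ?_
      invFun := Quot.lift (fun b => Quot.mk r (Function.surjInv hπ b)) ?_
      left_inv := ?_
      right_inv := ?_ })
  · rintro a b (⟨c, h⟩ | h)
    · refine Quot.sound ((joined_iff _ _ _ _).2 ⟨c, ?_⟩)
      rw [hpairs]
      exact List.mem_map.2 ⟨_, h, rfl⟩
    · exact congrArg _ ((hrel a b).2 (.rel _ _ h))
  · intro a' b' h
    obtain ⟨c, h⟩ := (joined_iff _ _ _ _).1 h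
    rw [hpairs] at h
    obtain ⟨⟨a, b⟩, hmem, hab⟩ := List.mem_map.1 h
    obtain ⟨rfl, rfl⟩ := Prod.ext_iff.1 hab
    have h₁ := hmk _ _ (hinv (π a))
    have h₂ := hmk _ _ (hinv (π b))
    have h₃ : Quot.mk r a = Quot.mk r b := Quot.sound (Or.inl ⟨c, hmem⟩)
    exact h₁.trans (h₃.trans h₂.symm)
  · rintro ⟨a⟩
    exact hmk _ _ (hinv (π a))
  · rintro ⟨a⟩
    exact congrArg _ (hinv a)

/-- A move that removes the crossings `k i`. The semiarcs in `I` are the sides of the disk that is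
collapsed by the move; they disappear. A coloring gives its outer colors to both ends of every
strand through the disk (`hthrough`), conversely such outer colors extend to the sides of the disk
(`hextend`) in one way (`hunique`), and the state sum in the disk is that of the straightened
strands up to the factor that the writhe accounts for (`hstate`). -/
theorem Forgets.sameBracketHomset {β : BiquandleBracket X R} {D D' : LinkDiagram}
    {K : Set D.Crossing} (hF : D.Forgets D' K) {n : ℕ} (k : Fin n → D.Crossing)
    (hk : Function.Injective k) (hK : Set.range k = K) (I : Set D.Semiarc)
    (hI : ∀ c ∉ K, ∀ s, D.inn (c, s) ∉ I ∧ D.out (c, s) ∉ I)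
    (houter : ∀ a ∈ I, ∃ b ∉ I, ∃ i s, a = D.inn (k i, s) ∧ b = D.out (k i, s) ∨
      b = D.inn (k i, s) ∧ a = D.out (k i, s))
    (hthrough : ∀ f : D.Semiarc → X, (∀ i, D.IsColoringAt f (k i)) → ∃ g : D.Semiarc → X,
      (∀ a ∉ I, g a = f a) ∧ ∀ i s, g (D.inn (k i, s)) = g (D.out (k i, s)))
    (hextend : ∀ g : D.Semiarc → X, (∀ i s, g (D.inn (k i, s)) = g (D.out (k i, s))) →
      ∃ f : D.Semiarc → X, (∀ a ∉ I, f a = g a) ∧ ∀ i, D.IsColoringAt f (k i))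
    (hunique : ∀ f g : D.Semiarc → X, (∀ i, D.IsColoringAt f (k i)) →
      (∀ i, D.IsColoringAt g (k i)) → (∀ a ∉ I, f a = g a) → ∀ a ∈ I, f a = g a)
    (hstate : ∀ f : D.Semiarc → X, (∀ i, D.IsColoringAt f (k i)) → ∀ E,
      (∀ m ∈ I, IsIsolated E m) →
      stateSum β.δ E (List.ofFn fun i => D.resolution β f (k i)) [] =
        ((β.w ^ (∑ i, (D.sign (k i) : ℤ)) : Rˣ) : R) *
          β.δ ^ numClasses E (D.straightPairs (List.ofFn k))) :
    SameBracketHomset β D D' := by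
  obtain ⟨e, π, hπ, hrel, hsign, hinn, hout⟩ := hF
  subst hK
  have he : ∀ c, (e c : D.Crossing) ∉ Set.range k := fun c => (e c).2
  have hrel' : ∀ a b, π a = π b ↔
      Relation.EqvGen (fun a b => (a, b) ∈ D.straightPairs (List.ofFn k)) a b := by
    intro a b
    rw [hrel]
    simp only [mem_straightPairs, List.mem_ofFn, Set.mem_range]
  have hπk : ∀ i s, π (D.inn (k i, s)) = π (D.out (k i, s)) := fun i s =>
    (hrel _ _).2 (.rel _ _ ⟨k i, ⟨i, rfl⟩, s, rfl, rfl⟩)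
  -- Functions that pass straight through the removed crossings factor through `π`.
  have hfactor : ∀ g : D.Semiarc → X, (∀ i s, g (D.inn (k i, s)) = g (D.out (k i, s))) →
      ∀ a b, π a = π b → g a = g b := by
    intro g hg a b hab
    have := (hrel a b).1 hab
    clear hab
    induction this with
    | rel a b h =>
      obtain ⟨_, ⟨i, rfl⟩, s, rfl, rfl⟩ := h
      exact hg i s
    | refl a => rfl
    | symm a b _ ih => exact ih.symm
    | trans a b c _ _ ih ih' => exact ih.trans ih'
  have hagree : ∀ (f : D.Semiarc → X) (f' : D'.Semiarc → X), (∀ a ∈ Iᶜ, f' (π a) = f a) →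
      ∀ c, (D'.IsColoringAt f' c ↔ D.IsColoringAt f (e c)) ∧
        ∀ (β : BiquandleBracket X R) s, D'.coeff β f' c s = D.coeff β f (e c) s := by
    intro f f' hff c
    refine crossing_congr (hsign c) (fun s => ?_) fun s => ?_
    · rw [hinn, hff _ (hI _ (he c) s).1]
    · rw [hout, hff _ (hI _ (he c) s).2]
  have hcol : ∀ f : D.Semiarc → X, (∀ i, D.IsColoringAt f (k i)) →
      (∀ c, D.IsColoringAt f (e c)) → D.IsColoring f := by
    intro f h₁ h₂ c
    by_cases hc : c ∈ Set.range k
    · obtain ⟨i, rfl⟩ := hc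
      exact h₁ i
    · have := h₂ (e.symm ⟨c, hc⟩)
      rwa [e.apply_symm_apply] at this
  have hfr : Function.Bijective (Sum.elim k fun c => (e c : D.Crossing)) := by
    refine ⟨hk.sumElim (Subtype.val_injective.comp e.injective) fun i c h => he c ⟨i, h⟩, ?_⟩
    intro c
    by_cases hc : c ∈ Set.range k
    · obtain ⟨i, rfl⟩ := hc
      exact ⟨.inl i, rfl⟩
    · exact ⟨.inr (e.symm ⟨c, hc⟩), by simp⟩
  let frame : Fin n ⊕ D'.Crossing ≃ D.Crossing := Equiv.ofBijective _ hfr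
  refine SameBracketHomset.of_agree Iᶜ π ?_ ?_ ?_ ?_ ?_
  · intro f hf
    obtain ⟨g, hgf, hg⟩ := hthrough f fun i => hf (k i)
    have hg' : ∀ a, g (Function.surjInv hπ (π a)) = g a := fun a =>
      hfactor g hg _ _ (Function.surjInv_eq hπ _)
    have hff : ∀ a ∈ Iᶜ, g (Function.surjInv hπ (π a)) = f a := fun a ha => by
      rw [hg', hgf a ha]
    exact ⟨fun b => g (Function.surjInv hπ b), fun c =>
      (hagree f (fun b => g (Function.surjInv hπ b)) hff c).1.2 (hf _), hff⟩
  · intro f' hf'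
    obtain ⟨f, hf, hfk⟩ := hextend (fun a => f' (π a)) fun i s => congrArg f' (hπk i s)
    have hff : ∀ a ∈ Iᶜ, f' (π a) = f a := fun a ha => (hf a ha).symm
    exact ⟨f, hcol f hfk fun c => (hagree f f' hff c).1.1 (hf' c), hff⟩
  · intro f g hf hg hfg
    funext a
    by_cases ha : a ∈ I
    · exact hunique f g (fun i => hf _) (fun i => hg _) hfg a ha
    · exact hfg a ha
  · intro f g _ _ hfg
    funext b
    obtain ⟨a, rfl⟩ := hπ b
    by_cases ha : a ∈ I
    · obtain ⟨b, hb, i, s, ⟨rfl, rfl⟩ | ⟨rfl, rfl⟩⟩ := houter a ha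
      · rw [hπk, hfg _ hb]
      · rw [← hπk, hfg _ hb]
    · exact hfg a ha
  · intro f f' hf _ hff
    rw [D.bracketValue_eq_sum β f frame, bracketValue]
    have hw : D.writhe = (∑ i, (D.sign (k i) : ℤ)) + D'.writhe := by
      unfold writhe
      rw [← frame.sum_comp, Fintype.sum_sum_type]
      congr 1
      exact Finset.sum_congr rfl fun c _ => by rw [hsign]; rfl
    rw [hw, Finset.mul_sum, Finset.mul_sum]
    refine Finset.sum_congr rfl fun σ _ => ?_
    have hs := hstate f (fun i => hf _) (D.outerJoined (fun c => (e c : D.Crossing)) σ)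
      fun m hm => isIsolated_outerJoined fun c s =>
        ⟨fun h => (hI _ (he c) s).1 (h ▸ hm), fun h => (hI _ (he c) s).2 (h ▸ hm)⟩
    have hl := loops_eq_of_forgets hπ hrel' hinn hout σ
    have hc : ∏ c, D'.coeff β f' c (σ c) = ∏ c, D.coeff β f (frame (.inr c)) (σ c) :=
      Finset.prod_congr rfl fun c _ => (hagree f f' hff c).2 β _
    change _ = _ * (_ * stateSum β.δ (D.outerJoined (fun c => (e c : D.Crossing)) σ)
      (List.ofFn fun i => D.resolution β f (k i)) [])
    rw [hs, hl, hc, neg_add, zpow_add, zpow_neg β.w (∑ i, _), Units.val_mul]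
    linear_combination (-(β.w ^ (-D'.writhe) : Rˣ) *
      (∏ c, D.coeff β f (frame (.inr c)) (σ c) : Rˣ) * β.δ ^ numClasses
        (D.outerJoined (fun c => (e c : D.Crossing)) σ) (D.straightPairs (List.ofFn k)) : R) *
      Units.inv_mul (β.w ^ ∑ i, (D.sign (k i) : ℤ))

end Transfer

end LinkDiagram

namespace LinkDiagram

section Moves

variable {X : Type u} {R : Type v} [Biquandle X] [CommRing R]

theorem SameBracketHomset.trans {β : BiquandleBracket X R} {D D' D'' : LinkDiagram}
    (h : SameBracketHomset β D D') (h' : SameBracketHomset β D' D'') :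
    SameBracketHomset β D D'' := by
  obtain ⟨Φ, h₁, h₂⟩ := h
  obtain ⟨Φ', h₁', h₂'⟩ := h'
  exact ⟨Φ.trans Φ', fun f => (h₁' _).trans (h₁ f),
    fun φ f => (congrArg Φ' (h₂ φ f)).trans (h₂' φ _)⟩

theorem Forgets.sameBracketHomset_of_empty (β : BiquandleBracket X R) {D D' : LinkDiagram}
    (h : D.Forgets D' ∅) : SameBracketHomset β D D' := by
  refine h.sameBracketHomset (n := 0) Fin.elim0 (fun i => i.elim0) (by simp) ∅ (by simp)
    (by simp) (fun f _ => ⟨f, by simp, fun i => i.elim0⟩)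
    (fun f _ => ⟨f, by simp, fun i => i.elim0⟩)
    (by simp) fun f _ E _ => ?_
  simp [stateSum, straightPairs]

/-- A semiarc that joins two strands meets only their crossings. -/
theorem ne_of_strandEnd_eq {D : LinkDiagram} {ε : ℤˣ} {a b : D.Crossing × Strand}
    (h : D.strandEnd ε a = D.strandEnd (-ε) b) {c : D.Crossing} (ha : c ≠ a.1) (hb : c ≠ b.1)
    (s : Strand) : D.inn (c, s) ≠ D.strandEnd ε a ∧ D.out (c, s) ≠ D.strandEnd ε a := by
  have key : ∀ η, D.strandEnd η (c, s) ≠ D.strandEnd ε a := by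
    intro η hη
    rcases strandEnd_eq_cases h hη with ⟨-, h⟩ | ⟨-, h⟩
    · exact ha (congrArg Prod.fst h)
    · exact hb (congrArg Prod.fst h)
  exact ⟨by simpa using key 1, by simpa using key (-1)⟩

theorem neg_ne_self_units (ε : ℤˣ) : -ε ≠ ε := by
  rcases Int.units_eq_one_or ε with rfl | rfl <;> decide

/-- The two ends of a strand, in the order in which a function compares them. -/
theorem forall_inn_eq_out_iff {D : LinkDiagram} {α : Type*} (q : D.Semiarc → α) (ε : ℤˣ)
    (a : D.Crossing × Strand) :
    q (D.inn a) = q (D.out a) ↔ q (D.strandEnd ε a) = q (D.strandEnd (-ε) a) := by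
  rcases Int.units_eq_one_or ε with rfl | rfl
  · simp
  · simp [eq_comm]

/-! ### The first Reidemeister move -/

/-- Since `x ▷ᵤ x = x ▷ₒ x`, the sideways map sends `(x, x)` to `(x ▷ᵤ x, x ▷ᵤ x)`. -/
theorem _root_.Biquandle.diagonal_injective :
    Function.Injective fun x : X => x ▷ᵤ x := by
  intro x y h
  have h' : x ▷ₒ x = y ▷ₒ y := by
    rw [← Biquandle.under_self, ← Biquandle.under_self]
    exact h
  exact congrArg Prod.fst (Biquandle.side_bijective.1 (a₁ := (x, x)) (a₂ := (y, y))
    (Prod.ext h' h))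

/-- At a kink the two outer ends have the same color. In one of the two cases this needs some `z`
with `z ▷ᵤ z = m`, which exists as `X` is finite. -/
theorem _root_.CornerRel.kink_eq [Finite X] {M : ℤˣ} {m a b : X}
    (h : CornerRel (-M) M m b m a) : b = a := by
  rcases Int.units_eq_one_or M with rfl | rfl <;>
    simp only [CornerRel, neg_one_ne_one_units, if_true, if_false, neg_neg] at h
  · obtain ⟨z, hz⟩ := Finite.injective_iff_surjective.1 Biquandle.diagonal_injective m
    have := Biquandle.side_bijective.1 (a₁ := (z, z)) (a₂ := (a, b))
      (Prod.ext ((Biquandle.under_self z).symm.trans (hz.trans h.2)) (hz.trans h.1))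
    exact (congrArg Prod.snd this).symm.trans (congrArg Prod.fst this)
  · rw [h.1, h.2, Biquandle.under_self]

/-- At a kink any color of the outer ends extends to the loop. In one of the two cases the color of
the loop is the `z` with `z ▷ᵤ z = a`, which exists as `X` is finite. -/
theorem _root_.CornerRel.exists_kink [Finite X] (M : ℤˣ) (a : X) :
    ∃ m, CornerRel (-M) M m a m a := by
  rcases Int.units_eq_one_or M with rfl | rfl <;>
    simp only [CornerRel, neg_one_ne_one_units, if_true, if_false, neg_neg]
  · exact ⟨_, rfl, Biquandle.under_self a⟩
  · obtain ⟨z, hz⟩ := Finite.injective_iff_surjective.1 Biquandle.diagonal_injective a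
    exact ⟨z, hz.symm, hz.symm.trans (Biquandle.under_self z)⟩

theorem _root_.CornerRel.kink_unique {M : ℤˣ} {m m' a : X} (h : CornerRel (-M) M m a m a)
    (h' : CornerRel (-M) M m' a m' a) : m = m' :=
  (h.unique_left h').1

/-- The factor that a kink contributes. -/
theorem _root_.BiquandleBracket.kink (β : BiquandleBracket X R) (x : X) (ε : ℤˣ) :
    ((β.B x x ^ (ε : ℤ) : Rˣ) : R) + ((β.A x x ^ (ε : ℤ) : Rˣ) : R) * β.δ =
      ((β.w ^ (ε : ℤ) : Rˣ) : R) := by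
  have hδ := β.δ_eq x x
  have hA := (β.A x x).mul_inv
  have hB := (β.B x x).mul_inv
  rw [← β.w_eq x]
  push_cast at hδ
  rcases Int.units_eq_one_or ε with rfl | rfl
  · simp only [Units.val_one, zpow_one]
    push_cast
    rw [← hδ]
    linear_combination (-(β.B x x) : R) * hA
  · have hinv : (-(β.A x x ^ 2 * (β.B x x)⁻¹))⁻¹ = -((β.A x x)⁻¹ ^ 2 * β.B x x) := by
      rw [inv_neg, mul_inv, inv_inv, inv_pow]
    simp only [Units.val_neg, Units.val_one, zpow_neg_one, hinv]
    push_cast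
    rw [← hδ]
    linear_combination (-((β.B x x)⁻¹ : Rˣ) : R) * hA

theorem rightUnder_eq (D : LinkDiagram) (c : D.Crossing) :
    D.rightUnder c = D.strandEnd (D.sign c) (c, .lower) := by
  unfold rightUnder strandEnd
  rfl

theorem rightOver_eq (D : LinkDiagram) (c : D.Crossing) :
    D.rightOver c = D.strandEnd (-D.sign c) (c, .upper) := by
  unfold rightOver
  rcases Int.units_eq_one_or (D.sign c) with h | h <;> simp [h]

theorem forall_mem_straightPairs {D : LinkDiagram} {l : List D.Crossing} {α : Type*}
    (q : D.Semiarc → α) : (∀ p ∈ D.straightPairs l, q p.1 = q p.2) ↔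
      ∀ c ∈ l, ∀ s, q (D.inn (c, s)) = q (D.out (c, s)) := by
  constructor
  · exact fun h c hc s => h (_, _) (mem_straightPairs.2 ⟨c, hc, s, rfl, rfl⟩)
  · rintro h ⟨_, _⟩ hp
    obtain ⟨c, hc, s, rfl, rfl⟩ := mem_straightPairs.1 hp
    exact h c hc s

theorem forall_strand_inn_eq_out_iff {D : LinkDiagram} {α : Type*} (g : D.Semiarc → α) (ε η : ℤˣ)
    (c : D.Crossing) : (∀ s, g (D.inn (c, s)) = g (D.out (c, s))) ↔
      g (D.strandEnd ε (c, .upper)) = g (D.strandEnd (-ε) (c, .upper)) ∧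
      g (D.strandEnd η (c, .lower)) = g (D.strandEnd (-η) (c, .lower)) := by
  rw [← forall_inn_eq_out_iff, ← forall_inn_eq_out_iff]
  exact ⟨fun h => ⟨h _, h _⟩, fun h s => by cases s; exacts [h.2, h.1]⟩

theorem kink_through_iff {D : LinkDiagram} {c : D.Crossing} {ε : ℤˣ}
    (hε : D.strandEnd ε (c, .upper) = D.strandEnd (-ε) (c, .lower)) {α : Type*}
    (g : D.Semiarc → α) : (∀ s, g (D.inn (c, s)) = g (D.out (c, s))) ↔
      g (D.strandEnd ε (c, .upper)) = g (D.strandEnd (-ε) (c, .upper)) ∧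
      g (D.strandEnd ε (c, .upper)) = g (D.strandEnd ε (c, .lower)) := by
  rw [forall_strand_inn_eq_out_iff g ε (-ε), neg_neg, ← hε]

theorem Forgets.sameBracketHomset_of_isKink [Finite X] (β : BiquandleBracket X R)
    {D D' : LinkDiagram} {c : D.Crossing} (hc : D.IsKink c) (hF : D.Forgets D' {c}) :
    SameBracketHomset β D D' := by
  classical
  obtain ⟨ε, hε⟩ : ∃ ε, D.strandEnd ε (c, .upper) = D.strandEnd (-ε) (c, .lower) := by
    rcases hc with h | h
    · exact ⟨1, by simp [h]⟩
    · exact ⟨-1, by simp [h]⟩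
  set m := D.strandEnd ε (c, .upper) with hm
  set b := D.strandEnd (-ε) (c, .upper) with hb
  set a := D.strandEnd ε (c, .lower) with ha
  have hbm : b ≠ m := by
    intro h
    rcases strandEnd_eq_cases hε h with ⟨h, -⟩ | ⟨-, h⟩
    · exact neg_ne_self_units ε h
    · simp at h
  have ham : a ≠ m := by
    intro h
    rcases strandEnd_eq_cases hε h with ⟨-, h⟩ | ⟨h, -⟩
    · simp at h
    · exact neg_ne_self_units ε h.symm
  have hcol : ∀ f : D.Semiarc → X, D.IsColoringAt f c ↔
      CornerRel (-(D.sign c * ε)) (D.sign c * ε) (f m) (f b) (f m) (f a) := by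
    intro f
    rw [D.isColoringAt_iff f c ε (-ε), ← hm, ← hb, ← hε, neg_neg, ← ha, mul_neg]
  have hstraight := fun g : D.Semiarc → X => kink_through_iff hε g
  refine hF.sameBracketHomset (n := 1) (fun _ => c) (fun _ _ _ => Subsingleton.elim _ _)
    (Set.range_const) {m} ?_ ?_ ?_ ?_ ?_ ?_
  · intro d hd s
    exact ne_of_strandEnd_eq hε hd hd s
  · rintro _ rfl
    refine ⟨b, hbm, 0, .upper, ?_⟩
    rw [hm, hb]
    rcases Int.units_eq_one_or ε with rfl | rfl <;> simp
  · intro f hf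
    have hf := (hcol f).1 (hf 0)
    refine ⟨Function.update f m (f b), fun x hx => Function.update_of_ne hx _ _, fun _ => ?_⟩
    rw [hstraight, Function.update_self, Function.update_of_ne hbm, Function.update_of_ne ham]
    exact ⟨rfl, hf.kink_eq⟩
  · intro g hg
    obtain ⟨h₁, h₂⟩ := (hstraight g).1 (hg 0)
    obtain ⟨z, hz⟩ := CornerRel.exists_kink (D.sign c * ε) (g b)
    refine ⟨Function.update g m z, fun x hx => Function.update_of_ne hx _ _, fun _ => ?_⟩
    rw [hcol, Function.update_self, Function.update_of_ne hbm, Function.update_of_ne ham,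
      ← h₂, h₁]
    exact hz
  · rintro f g hf hg hfg _ rfl
    have hf := (hcol f).1 (hf 0)
    have hg := (hcol g).1 (hg 0)
    rw [← hf.kink_eq] at hf
    rw [← hg.kink_eq, ← hfg b hbm] at hg
    exact hf.kink_unique hg
  · intro f hf E hE
    have hE := hE m rfl
    have hf := ((hcol f).1 (hf 0)).kink_eq
    -- The crossing has the same color twice on its right.
    have hright : f (D.rightUnder c) = f (D.rightOver c) := by
      rw [rightUnder_eq, rightOver_eq]
      by_cases h : D.sign c = ε
      · rw [h]; exact hf.symm
      · have h : D.sign c = -ε := Int.units_ne_iff_eq_neg.1 h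
        rw [h, neg_neg, ← hε]
    have hpair : D.crossingPair β f c ε (-ε) =
        (β.pair (f (D.rightOver c)) (f (D.rightOver c)) ^ (D.sign c : ℤ)).swap := by
      rw [crossingPair, hright, if_neg]
      rcases Int.units_eq_one_or ε with rfl | rfl <;> decide
    rw [List.ofFn_succ, List.ofFn_zero,
      stateSum_congr (.cons (D.resolution_equivalent β f c ε (-ε)) .nil)
      (l' := []) (fun _ => Iff.rfl), hpair, neg_neg, ← hm, ← hb, ← hε, ← ha]
    have hn : numClasses E [(m, a), (b, m)] =
        numClasses E (D.straightPairs (List.ofFn fun _ : Fin 1 => c)) := by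
      refine numClasses_congr fun q => ?_
      rw [forall_mem_straightPairs]
      simp only [List.ofFn_succ, List.ofFn_zero, List.mem_singleton, forall_eq,
        kink_through_iff hε q, List.forall_mem_cons, ← hm, ← hb, ← ha]
      grind
    have hn' : numClasses E [(m, m), (b, a)] = numClasses E [(m, a), (b, m)] + 1 := by
      rw [numClasses_congr (l := [(m, m), (b, a)]) (l' := [(b, a)]) (fun q => by simp),
        ← numClasses_cons_isolated hE (l := [(b, a)]) (by simp [hbm, ham]) ham]
      congr 1
      exact numClasses_congr fun q => by simp; grind
    have hk := β.kink (f (D.rightOver c)) (D.sign c)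
    simp only [stateSum, crossingResolution, List.append_nil, hn', hn, pow_succ]
    rw [Fin.sum_univ_one, ← hk]
    simp only [BiquandleBracket.pair, Prod.fst_swap, Prod.snd_swap, Prod.pow_fst, Prod.pow_snd]
    ring

/-! ### The second Reidemeister move -/

theorem isSkein_crossingPair (D : LinkDiagram) (β : BiquandleBracket X R) (f : D.Semiarc → X)
    (c : D.Crossing) (ε η : ℤˣ) : IsSkein β.δ (D.crossingPair β f c ε η) := by
  rw [crossingPair_eq]
  have h : ∀ {T M : ℤˣ} {u₀ u₁ v₀ v₁ : X}, IsSkein β.δ (β.cornerPair T M u₀ u₁ v₀ v₁) := by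
    intro T M u₀ u₁ v₀ v₁
    unfold BiquandleBracket.cornerPair
    by_cases h : T * M = 1
    · simpa only [if_pos h] using β.isSkein _ _
    · simpa only [if_neg h] using (β.isSkein _ _).swap_inv
  rcases Int.units_eq_one_or (D.sign c * ε * η) with h' | h' <;> rw [h']
  · simpa using h
  · simpa using h.inv

theorem Forgets.sameBracketHomset_of_isBigon (β : BiquandleBracket X R)
    {D D' : LinkDiagram} {c d : D.Crossing} (hcd : D.IsBigon c d) (hF : D.Forgets D' {c, d}) :
    SameBracketHomset β D D' := by
  classical
  obtain ⟨hsign, hl, ε, hε⟩ := hcd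
  have hdc : d ≠ c := by
    rintro rfl
    exact neg_ne_self_units _ hsign.symm
  have hsign' : D.sign d = -D.sign c := by rw [hsign, neg_neg]
  have hu := hε.strandEnd_eq
  have hl : D.strandEnd (-1) (c, .lower) = D.strandEnd 1 (d, .lower) := by simpa using hl
  have hu' : D.strandEnd (-ε) (c, .upper) = D.strandEnd (- -ε) (d, .upper) := by rwa [neg_neg]
  set U₁ := D.strandEnd (-ε) (c, .upper) with hU₁
  set L₁ := D.strandEnd (-1) (c, .lower) with hL₁
  set U₀ := D.strandEnd ε (c, .upper) with hU₀
  set U₂ := D.strandEnd (-ε) (d, .upper) with hU₂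
  set L₀ := D.strandEnd 1 (c, .lower) with hL₀
  set L₂ := D.strandEnd (-1) (d, .lower) with hL₂
  have hUL : U₁ ≠ L₁ := by
    intro h
    rcases strandEnd_eq_cases hu' h.symm with ⟨-, h⟩ | ⟨-, h⟩ <;> simp at h
  have hU₀' : U₀ ≠ U₁ ∧ U₀ ≠ L₁ := by
    constructor <;> intro h
    · rcases strandEnd_eq_cases hu' h with ⟨h, -⟩ | ⟨-, h⟩
      · exact neg_ne_self_units ε h.symm
      · exact hdc (congrArg Prod.fst h).symm
    · rcases strandEnd_eq_cases (ε := -1) hl h with ⟨-, h⟩ | ⟨-, h⟩ <;> simp at h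
  have hU₂' : U₂ ≠ U₁ ∧ U₂ ≠ L₁ := by
    constructor <;> intro h
    · rcases strandEnd_eq_cases hu' h with ⟨-, h⟩ | ⟨h, -⟩
      · exact hdc (congrArg Prod.fst h)
      · exact neg_ne_self_units _ h.symm
    · rcases strandEnd_eq_cases (ε := -1) hl h with ⟨-, h⟩ | ⟨-, h⟩ <;> simp at h
  have hL₀' : L₀ ≠ U₁ ∧ L₀ ≠ L₁ := by
    constructor <;> intro h
    · rcases strandEnd_eq_cases hu' h with ⟨-, h⟩ | ⟨-, h⟩ <;> simp at h
    · rcases strandEnd_eq_cases (ε := -1) hl h with ⟨h, -⟩ | ⟨-, h⟩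
      · exact absurd h (by decide)
      · exact hdc (congrArg Prod.fst h).symm
  have hL₂' : L₂ ≠ U₁ ∧ L₂ ≠ L₁ := by
    constructor <;> intro h
    · rcases strandEnd_eq_cases hu' h with ⟨-, h⟩ | ⟨-, h⟩ <;> simp at h
    · rcases strandEnd_eq_cases (ε := -1) hl h with ⟨-, h⟩ | ⟨h, -⟩
      · exact hdc (congrArg Prod.fst h)
      · exact absurd h (by decide)
  -- Both crossings impose the same relation, on the ends on either side of the bigon.
  have hc : ∀ f : D.Semiarc → X, D.IsColoringAt f c ↔
      CornerRel (D.sign c) (D.sign c * ε) (f U₀) (f U₁) (f L₀) (f L₁) := by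
    intro f
    rw [D.isColoringAt_iff f c ε 1, mul_one]
  have hd : ∀ f : D.Semiarc → X, D.IsColoringAt f d ↔
      CornerRel (D.sign c) (D.sign c * ε) (f U₂) (f U₁) (f L₂) (f L₁) := by
    intro f
    rw [D.isColoringAt_iff f d (-ε) (-1), hsign', neg_neg, neg_neg, ← hu, ← hl, neg_mul_neg,
      neg_mul_neg, mul_one]
  have hthrough : ∀ g : D.Semiarc → X,
      (∀ (i : Fin 2) s, g (D.inn (![c, d] i, s)) = g (D.out (![c, d] i, s))) ↔
      (g U₀ = g U₁ ∧ g L₀ = g L₁) ∧ g U₁ = g U₂ ∧ g L₁ = g L₂ := by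
    intro g
    have hgd := forall_strand_inn_eq_out_iff g ε 1 d
    rw [← hu, ← hl] at hgd
    exact Fin.forall_fin_two.trans (and_congr (forall_strand_inn_eq_out_iff g ε 1 c) hgd)
  refine hF.sameBracketHomset ![c, d] ?_ ?_ {U₁, L₁} ?_ ?_ ?_ ?_ ?_ ?_
  · intro i j hij
    fin_cases i <;> fin_cases j <;> simp_all
  · simp [Set.pair_comm]
  · intro x hx s
    simp only [Set.mem_insert_iff, Set.mem_singleton_iff, not_or] at hx ⊢
    have h₁ := ne_of_strandEnd_eq hu' hx.1 hx.2 s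
    have h₂ := ne_of_strandEnd_eq (ε := -1) hl hx.1 hx.2 s
    exact ⟨⟨h₁.1, h₂.1⟩, h₁.2, h₂.2⟩
  · rintro _ (rfl | rfl)
    · refine ⟨U₀, by simp [hU₀'], 0, .upper, ?_⟩
      rw [hU₁, hU₀]
      rcases Int.units_eq_one_or ε with rfl | rfl <;> simp
    · exact ⟨L₀, by simp [hL₀'], 0, .lower, by simp [hL₀, hL₁]⟩
  · intro f hf
    obtain ⟨h₁, h₂⟩ := ((hc f).1 (hf 0)).unique_left ((hd f).1 (hf 1))
    refine ⟨Function.update (Function.update f U₁ (f U₀)) L₁ (f L₀), fun x hx => ?_, ?_⟩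
    · simp only [Set.mem_insert_iff, Set.mem_singleton_iff, not_or] at hx
      rw [Function.update_of_ne hx.2, Function.update_of_ne hx.1]
    · rw [hthrough]
      simp [hUL, hU₀', hL₀', hU₂', hL₂', h₁, h₂]
  · intro g hg
    rw [hthrough] at hg
    obtain ⟨z, y, h⟩ := CornerRel.exists (D.sign c) (D.sign c * ε) (g U₀) (g L₀)
    refine ⟨Function.update (Function.update g U₁ z) L₁ y, fun x hx => ?_, ?_⟩
    · simp only [Set.mem_insert_iff, Set.mem_singleton_iff, not_or] at hx
      rw [Function.update_of_ne hx.2, Function.update_of_ne hx.1]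
    · refine Fin.forall_fin_two.2 ⟨?_, ?_⟩
      · refine (hc _).2 ?_
        simpa [Function.update_apply, hUL, hU₀', hL₀', hU₂', hL₂'] using h
      · refine (hd _).2 ?_
        simpa [Function.update_apply, hUL, hU₀', hL₀', hU₂', hL₂', ← hg.2.1, ← hg.2.2, ← hg.1.1,
          ← hg.1.2] using h
  · intro f g hf hg hfg
    have h := (hc f).1 (hf 0)
    rw [hfg U₀ (by simp [hU₀']), hfg L₀ (by simp [hL₀'])] at h
    obtain ⟨h₁, h₂⟩ := h.unique ((hc g).1 (hg 0))
    rintro _ (rfl | rfl)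
    exacts [h₁, h₂]
  · intro f hf E hE
    obtain ⟨h₁, h₂⟩ := ((hc f).1 (hf 0)).unique_left ((hd f).1 (hf 1))
    have hpair : D.crossingPair β f d (-ε) (-1) = (D.crossingPair β f c ε 1)⁻¹ := by
      rw [crossingPair_eq, crossingPair_eq, hsign', neg_neg, neg_neg, ← hu, ← hl, neg_mul_neg,
        neg_mul_neg, mul_one, mul_one, ← hU₀, ← hU₁, ← hU₂, ← hL₀, ← hL₁, ← hL₂, h₁, h₂,
        mul_neg_one, Units.val_neg, zpow_neg]
    have hsk := D.isSkein_crossingPair β f c ε 1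
    have hδ : ((((D.crossingPair β f c ε 1).1⁻¹ * (D.crossingPair β f c ε 1).2 : Rˣ) : R) +
        (((D.crossingPair β f c ε 1).1 * (D.crossingPair β f c ε 1).2⁻¹ : Rˣ) : R)) = -β.δ := by
      rw [IsSkein, ratio, mul_inv, inv_inv] at hsk
      rw [add_comm]
      exact hsk
    have hres := stateSum_bigon (E := E) hδ (hE U₁ (by simp)) (hE L₁ (by simp)) hUL hU₀' hU₂'
      hL₀' hL₂'
    have hsum : ∑ i, (D.sign (![c, d] i) : ℤ) = 0 := by simp [Fin.sum_univ_two, hsign']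
    have hofn : (List.ofFn fun i => D.resolution β f (![c, d] i)) =
        [D.resolution β f c, D.resolution β f d] := by simp [List.ofFn_succ]
    have hd' := D.resolution_equivalent β f d (-ε) (-1)
    rw [hpair, neg_neg, neg_neg, ← hu, ← hl] at hd'
    rw [hsum, hofn, stateSum_congr (.cons (D.resolution_equivalent β f c ε 1) (.cons hd' .nil))
      (l' := []) (fun _ => Iff.rfl)]
    refine hres.trans ?_
    rw [zpow_zero, Units.val_one, one_mul]
    congr 1
    refine numClasses_congr fun q => ?_
    have hqc := forall_strand_inn_eq_out_iff q ε 1 c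
    have hqd := forall_strand_inn_eq_out_iff q ε 1 d
    rw [← hu, ← hl] at hqd
    rw [forall_mem_straightPairs]
    simp only [List.ofFn_succ, List.ofFn_zero, List.forall_mem_cons, Matrix.cons_val_zero,
      Matrix.cons_val_succ, List.not_mem_nil, IsEmpty.forall_iff, implies_true, and_true, hqc, hqd,
      ← hU₀, ← hU₁, ← hU₂, ← hL₀, ← hL₁, ← hL₂]
    tauto

end Moves

end LinkDiagram

namespace LinkDiagram

/-! ### The third Reidemeister move -/

/-- The diagram after the third Reidemeister move, with the same crossings and semiarcs. -/
noncomputable def triangleMove (D : LinkDiagram) (p q r : D.Crossing) : LinkDiagram where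
  Crossing := D.Crossing
  Semiarc := D.Semiarc
  sign := D.sign
  inn := D.inn ∘ D.triangleSwap p q r
  out := D.out ∘ D.triangleSwap p q r
  inn_injective := D.inn_injective.comp (Equiv.injective _)
  out_injective := D.out_injective.comp (Equiv.injective _)
  range_inn_eq_range_out := by
    rw [(Equiv.surjective _).range_comp, (Equiv.surjective _).range_comp,
      D.range_inn_eq_range_out]

theorem triangleSwap_apply {D : LinkDiagram} {p q r : D.Crossing} (hpq : p ≠ q) (hpr : p ≠ r)
    (hqr : q ≠ r) :
    D.triangleSwap p q r (p, .upper) = (q, .upper) ∧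
    D.triangleSwap p q r (q, .upper) = (p, .upper) ∧
    D.triangleSwap p q r (p, .lower) = (r, .upper) ∧
    D.triangleSwap p q r (r, .upper) = (p, .lower) ∧
    D.triangleSwap p q r (q, .lower) = (r, .lower) ∧
    D.triangleSwap p q r (r, .lower) = (q, .lower) ∧
    ∀ c, c ≠ p → c ≠ q → c ≠ r → ∀ s, D.triangleSwap p q r (c, s) = (c, s) := by
  simp only [triangleSwap, Equiv.Perm.mul_apply]
  refine ⟨?_, ?_, ?_, ?_, ?_, ?_, fun c hp hq hr s => ?_⟩ <;>
    simp [Equiv.swap_apply_def, *, Ne.symm hpq, Ne.symm hpr, Ne.symm hqr]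

section Triangle

variable {X : Type u} {R : Type v} [Biquandle X] [CommRing R]

theorem _root_.TriangleRatios.zpow {δ : R} {p q r p' q' r' : Rˣ × Rˣ} {u : Rˣ}
    (h : TriangleRatios δ p q r p' q' r' u) (κ : ℤˣ) :
    TriangleRatios δ (p ^ (κ : ℤ)) (q ^ (κ : ℤ)) (r ^ (κ : ℤ)) (p' ^ (κ : ℤ)) (q' ^ (κ : ℤ))
      (r' ^ (κ : ℤ)) u := by
  rcases Int.units_eq_one_or κ with rfl | rfl
  · simpa using h
  · simpa using h.inv

theorem injective_vec_three {α : Type*} {a b c : α} (hab : a ≠ b) (hac : a ≠ c) (hbc : b ≠ c) :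
    Function.Injective ![a, b, c] := by
  intro i j hij
  fin_cases i <;> fin_cases j <;> simp_all [eq_comm]

/-- The top, middle and bottom strands have the semiarcs `u₀, u₁, u₂`, `v₀, v₁, v₂` and
`w₀, w₁, w₂`, starting at the first of the two crossings on the strand, so that `u₁`, `v₁`, `w₁` are
the sides of the triangle. The move only changes the crossings at which they meet. -/
theorem IsTriangle.sameBracketHomset (β : BiquandleBracket X R) {D : LinkDiagram}
    {p q r : D.Crossing} (h : D.IsTriangle p q r) :
    SameBracketHomset β D (D.triangleMove p q r) := by
  obtain ⟨hpq, hpr, hqr, t, m, b, κ, ht, hm, hb, hp, hq, hr⟩ := h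
  have hu := ht.strandEnd_eq
  have hv := hm.strandEnd_eq
  have hw := hb.strandEnd_eq
  obtain ⟨s₁, s₂, s₃, s₄, s₅, s₆, s₇⟩ := triangleSwap_apply hpq hpr hqr
  set D' := D.triangleMove p q r with hD'
  set u₁ := D.strandEnd (-t) (p, .upper) with hu₁
  set v₁ := D.strandEnd (-m) (p, .lower) with hv₁
  set w₁ := D.strandEnd (-b) (q, .lower) with hw₁
  set u₀ := D.strandEnd t (p, .upper) with hu₀
  set v₀ := D.strandEnd m (p, .lower) with hv₀
  set w₀ := D.strandEnd b (q, .lower) with hw₀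
  set u₂ := D.strandEnd (-t) (q, .upper) with hu₂
  set v₂ := D.strandEnd (-m) (r, .upper) with hv₂
  set w₂ := D.strandEnd (-b) (r, .lower) with hw₂
  have hu' : u₁ = D.strandEnd (- -t) (q, .upper) := by rwa [neg_neg]
  have hv' : v₁ = D.strandEnd (- -m) (r, .upper) := by rwa [neg_neg]
  have hw' : w₁ = D.strandEnd (- -b) (r, .lower) := by rwa [neg_neg]
  have ne_u : ∀ η a, (η = -t → a ≠ (p, .upper)) → (η = t → a ≠ (q, .upper)) →
      D.strandEnd η a ≠ u₁ := by
    intro η a h₁ h₂ h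
    rcases strandEnd_eq_cases hu' h with ⟨h, h'⟩ | ⟨h, h'⟩
    exacts [h₁ h h', h₂ (h.trans (neg_neg t)) h']
  have ne_v : ∀ η a, (η = -m → a ≠ (p, .lower)) → (η = m → a ≠ (r, .upper)) →
      D.strandEnd η a ≠ v₁ := by
    intro η a h₁ h₂ h
    rcases strandEnd_eq_cases hv' h with ⟨h, h'⟩ | ⟨h, h'⟩
    exacts [h₁ h h', h₂ (h.trans (neg_neg m)) h']
  have ne_w : ∀ η a, (η = -b → a ≠ (q, .lower)) → (η = b → a ≠ (r, .lower)) →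
      D.strandEnd η a ≠ w₁ := by
    intro η a h₁ h₂ h
    rcases strandEnd_eq_cases hw' h with ⟨h, h'⟩ | ⟨h, h'⟩
    exacts [h₁ h h', h₂ (h.trans (neg_neg b)) h']
  have nt := neg_ne_self_units t
  have nm := neg_ne_self_units m
  have nb := neg_ne_self_units b
  have huv : u₁ ≠ v₁ := ne_v _ _ (by simp) (by simp [hpr])
  have huw : u₁ ≠ w₁ := ne_w _ _ (by simp) (by simp)
  have hvw : v₁ ≠ w₁ := ne_w _ _ (by simp [hpq]) (by simp [hpr])
  have gu₀ : u₀ ≠ u₁ ∧ u₀ ≠ v₁ ∧ u₀ ≠ w₁ :=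
    ⟨ne_u _ _ (by simp [nt.symm]) (by simp [hpq]), ne_v _ _ (by simp) (by simp [hpr]),
      ne_w _ _ (by simp) (by simp)⟩
  have gu₂ : u₂ ≠ u₁ ∧ u₂ ≠ v₁ ∧ u₂ ≠ w₁ :=
    ⟨ne_u _ _ (by simp [hpq.symm]) (by simp [nt]), ne_v _ _ (by simp) (by simp [hqr]),
      ne_w _ _ (by simp) (by simp)⟩
  have gv₀ : v₀ ≠ u₁ ∧ v₀ ≠ v₁ ∧ v₀ ≠ w₁ :=
    ⟨ne_u _ _ (by simp) (by simp), ne_v _ _ (by simp [nm.symm]) (by simp),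
      ne_w _ _ (by simp [hpq]) (by simp [hpr])⟩
  have gv₂ : v₂ ≠ u₁ ∧ v₂ ≠ v₁ ∧ v₂ ≠ w₁ :=
    ⟨ne_u _ _ (by simp [hpr.symm]) (by simp [hqr.symm]), ne_v _ _ (by simp) (by simp [nm]),
      ne_w _ _ (by simp) (by simp)⟩
  have gw₀ : w₀ ≠ u₁ ∧ w₀ ≠ v₁ ∧ w₀ ≠ w₁ :=
    ⟨ne_u _ _ (by simp) (by simp), ne_v _ _ (by simp [hpq.symm]) (by simp),
      ne_w _ _ (by simp [nb.symm]) (by simp [hqr])⟩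
  have gw₂ : w₂ ≠ u₁ ∧ w₂ ≠ v₁ ∧ w₂ ≠ w₁ :=
    ⟨ne_u _ _ (by simp) (by simp), ne_v _ _ (by simp [hpr.symm]) (by simp),
      ne_w _ _ (by simp [hqr.symm]) (by simp [nb])⟩
  -- The relations at the three crossings, in terms of the signs `κ * t`, `κ * m`, `κ * b`.
  have ptt : D.sign p * t = κ * m := by
    rw [hp, mul_right_comm, mul_assoc κ t t, Int.units_mul_self, mul_one]
  have pmm : D.sign p * m = κ * t := by rw [hp, mul_assoc, Int.units_mul_self, mul_one]
  have qtt : D.sign q * t = κ * b := by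
    rw [hq, mul_right_comm, mul_assoc κ t t, Int.units_mul_self, mul_one]
  have qbb : D.sign q * b = κ * t := by rw [hq, mul_assoc, Int.units_mul_self, mul_one]
  have rmm : D.sign r * m = κ * b := by
    rw [hr, mul_right_comm, mul_assoc κ m m, Int.units_mul_self, mul_one]
  have rbb : D.sign r * b = κ * m := by rw [hr, mul_assoc, Int.units_mul_self, mul_one]
  have cp : ∀ f : D.Semiarc → X, D.IsColoringAt f p ↔
      CornerRel (κ * t) (κ * m) (f u₀) (f u₁) (f v₀) (f v₁) := by
    intro f
    rw [D.isColoringAt_iff f p t m, ptt, pmm]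
  have cq : ∀ f : D.Semiarc → X, D.IsColoringAt f q ↔
      CornerRel (κ * t) (κ * b) (f u₁) (f u₂) (f w₀) (f w₁) := by
    intro f
    rw [D.isColoringAt_iff f q t b, qtt, qbb, ← hu]
  have cr : ∀ f : D.Semiarc → X, D.IsColoringAt f r ↔
      CornerRel (κ * m) (κ * b) (f v₁) (f v₂) (f w₁) (f w₂) := by
    intro f
    rw [D.isColoringAt_iff f r m b, rmm, rbb, ← hv, ← hw]
  -- The ends of the strands at the three crossings after the move.
  have fu : ∀ ε, D'.strandEnd ε (p, .upper) = D.strandEnd ε (q, .upper) :=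
    fun ε => congrArg (D.strandEnd ε) s₁
  have fu' : ∀ ε, D'.strandEnd ε (q, .upper) = D.strandEnd ε (p, .upper) :=
    fun ε => congrArg (D.strandEnd ε) s₂
  have fv : ∀ ε, D'.strandEnd ε (p, .lower) = D.strandEnd ε (r, .upper) :=
    fun ε => congrArg (D.strandEnd ε) s₃
  have fv' : ∀ ε, D'.strandEnd ε (r, .upper) = D.strandEnd ε (p, .lower) :=
    fun ε => congrArg (D.strandEnd ε) s₄
  have fw : ∀ ε, D'.strandEnd ε (q, .lower) = D.strandEnd ε (r, .lower) :=
    fun ε => congrArg (D.strandEnd ε) s₅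
  have fw' : ∀ ε, D'.strandEnd ε (r, .lower) = D.strandEnd ε (q, .lower) :=
    fun ε => congrArg (D.strandEnd ε) s₆
  have fs : ∀ c : D.Crossing, D'.sign c = D.sign c := fun _ => rfl
  have cp' : ∀ f : D.Semiarc → X, D'.IsColoringAt f p ↔
      CornerRel (κ * t) (κ * m) (f u₁) (f u₂) (f v₁) (f v₂) := by
    intro f
    rw [D'.isColoringAt_iff f p t m, fu, fu, fv, fv, fs, ptt, pmm, ← hu, ← hv]
  have cq' : ∀ f : D.Semiarc → X, D'.IsColoringAt f q ↔
      CornerRel (κ * t) (κ * b) (f u₀) (f u₁) (f w₁) (f w₂) := by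
    intro f
    rw [D'.isColoringAt_iff f q t b, fu', fu', fw, fw, fs, qtt, qbb, ← hw]
  have cr' : ∀ f : D.Semiarc → X, D'.IsColoringAt f r ↔
      CornerRel (κ * m) (κ * b) (f v₀) (f v₁) (f w₀) (f w₁) := by
    intro f
    rw [D'.isColoringAt_iff f r m b, fv', fv', fw', fw', fs, rmm, rbb]
  let k : Fin 3 → D.Crossing := ![p, q, r]
  have hk : Function.Injective k := injective_vec_three hpq hpr hqr
  let O : Set D.Semiarc := {u₁, v₁, w₁}ᶜ
  have hO : ∀ {a}, a ∈ O ↔ a ≠ u₁ ∧ a ≠ v₁ ∧ a ≠ w₁ := by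
    intro a
    simp [O]
  have hrange : ∀ {c}, c ∉ Set.range k → c ≠ p ∧ c ≠ q ∧ c ≠ r := by
    intro c hc
    refine ⟨?_, ?_, ?_⟩ <;> rintro rfl
    exacts [hc ⟨0, rfl⟩, hc ⟨1, rfl⟩, hc ⟨2, rfl⟩]
  have houter : ∀ c ∉ Set.range k, ∀ s, D.inn (c, s) ∈ O ∧ D.out (c, s) ∈ O := by
    intro c hc s
    obtain ⟨h₁, h₂, h₃⟩ := hrange hc
    have hu := ne_of_strandEnd_eq hu' h₁ h₂ s
    have hv := ne_of_strandEnd_eq hv' h₁ h₃ s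
    have hw := ne_of_strandEnd_eq hw' h₂ h₃ s
    exact ⟨hO.2 ⟨hu.1, hv.1, hw.1⟩, hO.2 ⟨hu.2, hv.2, hw.2⟩⟩
  have hfix : ∀ c ∉ Set.range k, ∀ s, D'.inn (c, s) = D.inn (c, s) ∧
      D'.out (c, s) = D.out (c, s) := by
    intro c hc s
    obtain ⟨h₁, h₂, h₃⟩ := hrange hc
    exact ⟨congrArg D.inn (s₇ c h₁ h₂ h₃ s), congrArg D.out (s₇ c h₁ h₂ h₃ s)⟩
  have hagree : ∀ f f' : D.Semiarc → X, (∀ a ∈ O, f' a = f a) → ∀ c ∉ Set.range k,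
      (D'.IsColoringAt f' c ↔ D.IsColoringAt f c) ∧
        ∀ (β : BiquandleBracket X R) s, D'.coeff β f' c s = D.coeff β f c s := by
    intro f f' hff c hc
    refine crossing_congr (D' := D') rfl (fun s => ?_) fun s => ?_
    · rw [(hfix c hc s).1, hff _ (houter c hc s).1]
    · rw [(hfix c hc s).2, hff _ (houter c hc s).2]
  -- New colors for the sides of the triangle.
  classical
  let upd : (D.Semiarc → X) → X → X → X → D.Semiarc → X := fun f x y z =>
    Function.update (Function.update (Function.update f u₁ x) v₁ y) w₁ z
  have upd_of : ∀ f x y z, ∀ a ∈ O, upd f x y z a = f a := by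
    intro f x y z a ha
    obtain ⟨h₁, h₂, h₃⟩ := hO.1 ha
    simp [upd, h₁, h₂, h₃]
  have upd_u : ∀ f x y z, upd f x y z u₁ = x := by
    intro f x y z
    simp [upd, huv, huw]
  have upd_v : ∀ f x y z, upd f x y z v₁ = y := by
    intro f x y z
    simp [upd, hvw]
  have upd_w : ∀ f x y z, upd f x y z w₁ = z := by
    intro f x y z
    simp [upd]
  have mem : u₀ ∈ O ∧ u₂ ∈ O ∧ v₀ ∈ O ∧ v₂ ∈ O ∧ w₀ ∈ O ∧ w₂ ∈ O :=
    ⟨hO.2 gu₀, hO.2 gu₂, hO.2 gv₀, hO.2 gv₂, hO.2 gw₀, hO.2 gw₂⟩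
  obtain ⟨mu₀, mu₂, mv₀, mv₂, mw₀, mw₂⟩ := mem
  have ext : ∀ f g : D.Semiarc → X, (∀ a ∈ O, f a = g a) → f u₁ = g u₁ → f v₁ = g v₁ →
      f w₁ = g w₁ → f = g := by
    intro f g h h₁ h₂ h₃
    funext a
    by_cases ha : a ∈ O
    · exact h a ha
    · by_cases e₁ : a = u₁
      · rw [e₁, h₁]
      by_cases e₂ : a = v₁
      · rw [e₂, h₂]
      by_cases e₃ : a = w₁
      · rw [e₃, h₃]
      · exact absurd (hO.2 ⟨e₁, e₂, e₃⟩) ha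
  have unique' : ∀ f g : D.Semiarc → X, D'.IsColoring f → D'.IsColoring g →
      (∀ a ∈ O, f a = g a) → f = g := by
    intro f g hf hg hfg
    have h₁ := (cp' f).1 (hf p)
    have h₂ := (cr' f).1 (hf r)
    rw [hfg _ mu₂, hfg _ mv₂] at h₁
    rw [hfg _ mv₀, hfg _ mw₀] at h₂
    obtain ⟨e₁, e₂⟩ := h₁.unique_left ((cp' g).1 (hg p))
    exact ext f g hfg e₁ e₂ (h₂.unique ((cr' g).1 (hg r))).2
  -- The coloring after the move, and the relation between the coefficients.
  have transfer : ∀ f : D.Semiarc → X, D.IsColoring f → ∃ f' : D.Semiarc → X,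
      D'.IsColoring f' ∧ (∀ a ∈ O, f' a = f a) ∧
      ∃ u, TriangleRatios β.δ (D.crossingPair β f p t m) (D.crossingPair β f q t b)
        (D.crossingPair β f r m b) (D'.crossingPair β f' p t m) (D'.crossingPair β f' q t b)
        (D'.crossingPair β f' r m b) u := by
    intro f hf
    obtain ⟨x, y, z, h₁, h₂, h₃, u, h⟩ := β.exists_triangle ((cp f).1 (hf p)) ((cq f).1 (hf q))
      ((cr f).1 (hf r))
    refine ⟨upd f x y z, fun c => ?_, upd_of f x y z, u, ?_⟩
    · by_cases hc : c ∈ Set.range k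
      · obtain ⟨i, rfl⟩ := hc
        fin_cases i
        · refine (cp' _).2 ?_
          rwa [upd_u, upd_v, upd_of f x y z _ mu₂, upd_of f x y z _ mv₂]
        · refine (cq' _).2 ?_
          rwa [upd_u, upd_w, upd_of f x y z _ mu₀, upd_of f x y z _ mw₂]
        · refine (cr' _).2 ?_
          rwa [upd_v, upd_w, upd_of f x y z _ mv₀, upd_of f x y z _ mw₀]
      · exact (hagree f _ (upd_of f x y z) c hc).1.2 (hf c)
    · have hκ : ∀ ε : ℤˣ, κ * ε * ε = κ := fun ε => by
        rw [mul_assoc, Int.units_mul_self, mul_one]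
      have dp : D.crossingPair β f p t m =
          β.cornerPair (κ * t) (κ * m) (f u₀) (f u₁) (f v₀) (f v₁) ^ (κ : ℤ) := by
        rw [D.crossingPair_eq β f p t m, ptt, pmm, hκ]
      have dq : D.crossingPair β f q t b =
          β.cornerPair (κ * t) (κ * b) (f u₁) (f u₂) (f w₀) (f w₁) ^ (κ : ℤ) := by
        rw [D.crossingPair_eq β f q t b, qtt, qbb, hκ, ← hu]
      have dr : D.crossingPair β f r m b =
          β.cornerPair (κ * m) (κ * b) (f v₁) (f v₂) (f w₁) (f w₂) ^ (κ : ℤ) := by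
        rw [D.crossingPair_eq β f r m b, rmm, rbb, hκ, ← hv, ← hw]
      have dp' : ∀ g : D.Semiarc → X, D'.crossingPair β g p t m =
          β.cornerPair (κ * t) (κ * m) (g u₁) (g u₂) (g v₁) (g v₂) ^ (κ : ℤ) := by
        intro g
        rw [D'.crossingPair_eq β g p t m, fu, fu, fv, fv, fs, ptt, pmm, hκ, ← hu, ← hv]
      have dq' : ∀ g : D.Semiarc → X, D'.crossingPair β g q t b =
          β.cornerPair (κ * t) (κ * b) (g u₀) (g u₁) (g w₁) (g w₂) ^ (κ : ℤ) := by
        intro g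
        rw [D'.crossingPair_eq β g q t b, fu', fu', fw, fw, fs, qtt, qbb, hκ, ← hw]
      have dr' : ∀ g : D.Semiarc → X, D'.crossingPair β g r m b =
          β.cornerPair (κ * m) (κ * b) (g v₀) (g v₁) (g w₀) (g w₁) ^ (κ : ℤ) := by
        intro g
        rw [D'.crossingPair_eq β g r m b, fv', fv', fw', fw', fs, rmm, rbb, hκ]
      rw [dp, dq, dr, dp' (upd f x y z), dq' (upd f x y z), dr' (upd f x y z), upd_u, upd_v,
        upd_w, upd_of f x y z _ mu₀, upd_of f x y z _ mu₂, upd_of f x y z _ mv₀,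
        upd_of f x y z _ mv₂, upd_of f x y z _ mw₀, upd_of f x y z _ mw₂]
      exact h.zpow κ
  refine SameBracketHomset.of_agree (D' := D') O id ?_ ?_ ?_ ?_ ?_
  · intro f hf
    obtain ⟨f', h₁, h₂, -⟩ := transfer f hf
    exact ⟨f', h₁, h₂⟩
  · -- The move is its own inverse if the three strands are traversed backwards.
    intro (f' : D.Semiarc → X) hf'
    obtain ⟨x, y, z, h₁, h₂, h₃, -⟩ := β.exists_triangle ((cp' f').1 (hf' p)).symm
      ((cq' f').1 (hf' q)).symm ((cr' f').1 (hf' r)).symm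
    have h₁ := h₁.symm
    have h₂ := h₂.symm
    have h₃ := h₃.symm
    rw [neg_neg, neg_neg] at h₁ h₂ h₃
    refine ⟨upd f' x y z, fun c => ?_, fun a ha => (upd_of f' x y z a ha).symm⟩
    by_cases hc : c ∈ Set.range k
    · obtain ⟨i, rfl⟩ := hc
      fin_cases i
      · refine (cp _).2 ?_
        rwa [upd_u, upd_v, upd_of f' x y z _ mu₀, upd_of f' x y z _ mv₀]
      · refine (cq _).2 ?_
        rwa [upd_u, upd_w, upd_of f' x y z _ mu₂, upd_of f' x y z _ mw₀]
      · refine (cr _).2 ?_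
        rwa [upd_v, upd_w, upd_of f' x y z _ mv₂, upd_of f' x y z _ mw₂]
    · exact (hagree _ f' (fun a ha => (upd_of f' x y z a ha).symm) c hc).1.1 (hf' c)
  · intro f g hf hg hfg
    have h₁ := (cp f).1 (hf p)
    have h₂ := (cr f).1 (hf r)
    rw [hfg _ mu₀, hfg _ mv₀] at h₁
    rw [hfg _ mv₂, hfg _ mw₂] at h₂
    obtain ⟨e₁, e₂⟩ := h₁.unique ((cp g).1 (hg p))
    exact ext f g hfg e₁ e₂ (h₂.unique_left ((cr g).1 (hg r))).2
  · exact unique'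
  · intro f (f' : D.Semiarc → X) hf hf' hff
    obtain ⟨g, hg, hgf, u, h⟩ := transfer f hf
    obtain rfl := unique' f' g hf' hg fun a ha => (hff a ha).trans (hgf a ha).symm
    let frame : Fin 3 ⊕ {c // c ∉ Set.range k} ≃ D.Crossing :=
      (Equiv.sumCongr (Equiv.ofInjective k hk) (Equiv.refl _)).trans (Equiv.Set.sumCompl _)
    let frame' : Fin 3 ⊕ {c // c ∉ Set.range k} ≃ D'.Crossing := frame
    let e : {c // c ∉ Set.range k} → D.Crossing := Subtype.val
    rw [D.bracketValue_eq_sum β f frame, D'.bracketValue_eq_sum β f' frame']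
    refine congrArg (_ * ·) (Finset.sum_congr rfl fun σ _ => ?_)
    have hc : ∏ c, D'.coeff β f' (e c) (σ c) = ∏ c, D.coeff β f (e c) (σ c) :=
      Finset.prod_congr rfl fun c _ => (hagree f f' hff c c.2).2 β _
    have hE : D'.outerJoined e σ = D.outerJoined e σ := by
      have : ∀ c, D'.smoothPairs (e c) (σ c) = D.smoothPairs (e c) (σ c) := by
        rintro ⟨c, hc⟩
        obtain ⟨e₁, e₂⟩ := hfix c hc .upper
        obtain ⟨e₃, e₄⟩ := hfix c hc .lower
        cases σ ⟨c, hc⟩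
        · exact congrArg₂ List.cons (congrArg₂ Prod.mk e₁ e₄)
            (congrArg₂ List.cons (congrArg₂ Prod.mk e₃ e₂) rfl)
        · exact congrArg₂ List.cons (congrArg₂ Prod.mk e₁ e₃)
            (congrArg₂ List.cons (congrArg₂ Prod.mk e₂ e₄) rfl)
      funext a b
      exact propext (exists_congr fun c => iff_of_eq (congrArg ((a, b) ∈ ·) (this c)))
    have iso : ∀ a ∉ O, IsIsolated (D.outerJoined e σ) a :=
      fun a ha => isIsolated_outerJoined fun c s =>
        ⟨fun h => ha (h ▸ (houter c c.2 s).1), fun h => ha (h ▸ (houter c c.2 s).2)⟩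
    have isou : IsIsolated (D.outerJoined e σ) u₁ := iso _ fun h => (hO.1 h).1 rfl
    have isov : IsIsolated (D.outerJoined e σ) v₁ := iso _ fun h => (hO.1 h).2.1 rfl
    have isow : IsIsolated (D.outerJoined e σ) w₁ := iso _ fun h => (hO.1 h).2.2 rfl
    have rp := D.resolution_equivalent β f p t m
    have rq := D.resolution_equivalent β f q t b
    have rr := D.resolution_equivalent β f r m b
    have rp' := D'.resolution_equivalent β f' p t m
    have rq' := D'.resolution_equivalent β f' q t b
    have rr' := D'.resolution_equivalent β f' r m b
    rw [← hu] at rq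
    rw [← hv, ← hw] at rr
    rw [fu, fu, fv, fv, ← hu, ← hv] at rp'
    rw [fu', fu', fw, fw, ← hw] at rq'
    rw [fv', fv', fw', fw'] at rr'
    have before := stateSum_congr (δ := β.δ) (E := D.outerJoined e σ)
      (.cons rp (.cons rq (.cons rr .nil))) (l := []) (l' := []) fun _ => Iff.rfl
    have after := stateSum_congr (δ := β.δ) (E := D.outerJoined e σ)
      (.cons rp' (.cons rq' (.cons rr' .nil))) (l := []) (l' := []) fun _ => Iff.rfl
    have middle := h.triangleRel.stateSum_eq isou isov isow huv huw hvw gu₀ gu₂ gv₀ gv₂ gw₀ gw₂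
    exact congrArg₂ (· * ·) (congrArg Units.val hc)
      ((congrArg (fun E => stateSum β.δ E [D'.resolution β f' p, D'.resolution β f' q,
        D'.resolution β f' r] []) hE).trans (after.trans (middle.symm.trans before.symm)))

end Triangle

end LinkDiagram

/-! ### Invariance of the quiver polynomials -/

section Invariance

variable {X : Type u} {R : Type v} [Biquandle X] [CommRing R]

theorem LinkDiagram.Move.sameBracketHomset [Finite X] (β : BiquandleBracket X R)
    {D D' : LinkDiagram} (h : D.Move D') : SameBracketHomset β D D' := by
  cases h with
  | isotopy h => exact h.sameBracketHomset_of_empty β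
  | r1 c hc h => exact h.sameBracketHomset_of_isKink β hc
  | r2 c d hcd h => exact h.sameBracketHomset_of_isBigon β hcd
  | r3 p q r hpqr e g hsign hinn hout =>
    refine (hpqr.sameBracketHomset β).trans (Forgets.sameBracketHomset_of_empty β ?_)
    refine ⟨e.trans (Equiv.subtypeUnivEquiv fun c => Set.notMem_empty c).symm, g.symm,
      g.symm.surjective, fun a b => ?_, hsign, fun c s => ?_, fun c s => ?_⟩
    · refine g.symm.injective.eq_iff.trans ⟨fun h => h ▸ .refl _, fun h => ?_⟩
      induction h with
      | rel a b h =>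
        obtain ⟨c, hc, -⟩ := h
        exact absurd hc (Set.notMem_empty c)
      | refl a => rfl
      | symm a b _ ih => exact ih.symm
      | trans a b c _ _ ih ih' => exact ih.trans ih'
    · exact g.eq_symm_apply.2 (hinn c s)
    · exact g.eq_symm_apply.2 (hout c s)

/-- The bijection between the homsets is an isomorphism of the weighted quivers. -/
theorem LinkDiagram.SameBracketHomset.polynomials_eq [Finite X] {β : BiquandleBracket X R}
    {D D' : LinkDiagram} (h : SameBracketHomset β D D') (S : Set (BiquandleHom X X)) :
    (D.bracketQuiver β S).inDegreePolynomial = (D'.bracketQuiver β S).inDegreePolynomial ∧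
    (D.bracketQuiver β S).twoVariablePolynomial =
      (D'.bracketQuiver β S).twoVariablePolynomial := by
  obtain ⟨Φ, hβ, hΦ⟩ := h
  let Q := D.bracketQuiver β S
  let Q' := D'.bracketQuiver β S
  let Φ : Q.V ≃ Q'.V := Φ
  let Ψ : Q.E ≃ Q'.E := Equiv.prodCongr Φ (Equiv.refl S)
  have hweight : ∀ f, Q'.weight (Φ f) = Q.weight f := hβ
  have hsource : ∀ e, Q'.source (Ψ e) = Φ (Q.source e) := fun e => rfl
  have htarget : ∀ e, Q'.target (Ψ e) = Φ (Q.target e) := fun e => (hΦ e.2.1 e.1).symm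
  have hdegree : ∀ f, Q'.inDegree (Φ f) = Q.inDegree f := fun f =>
    Nat.card_congr (Ψ.subtypeEquiv fun e => by rw [htarget, Φ.apply_eq_iff_eq]).symm
  constructor
  · refine Fintype.sum_equiv Φ _ _ fun f => ?_
    rw [hweight, hdegree]
  · refine Fintype.sum_equiv Ψ _ _ fun e => ?_
    rw [hsource, htarget, hweight, hweight]

end Invariance

theorem mainTheorem2 {X : Type u} {R : Type v} [Biquandle X] [Finite X] [CommRing R]
    (β : BiquandleBracket X R) (S : Set (BiquandleHom X X))
    (D D' : ClassicalDiagram) (h : D.link = D'.link) :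
    (D.1.bracketQuiver β S).inDegreePolynomial = (D'.1.bracketQuiver β S).inDegreePolynomial ∧
    (D.1.bracketQuiver β S).twoVariablePolynomial =
      (D'.1.bracketQuiver β S).twoVariablePolynomial := by
  refine ⟨congrArg (Quot.lift (fun D : ClassicalDiagram =>
    (D.1.bracketQuiver β S).inDegreePolynomial) ?_) h, congrArg (Quot.lift
    (fun D : ClassicalDiagram => (D.1.bracketQuiver β S).twoVariablePolynomial) ?_) h⟩
  · exact fun D D' h => ((h.sameBracketHomset β).polynomials_eq S).1
  · exact fun D D' h => ((h.sameBracketHomset β).polynomials_eq S).2
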